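/- Let $x(z)=z+1/z$ on $\mathbb P^1$, $B(z,w)=\frac{\mathrm dz\,\mathrm dw}{(z-w)^2}$, and let $\ln$ be the logarithm with branch cut on $\mathrm i\mathbb R_{\le 0}$ and $\ln 1=0$. Let $\varepsilon\in\{1,-1\}$ and $y(z)=\varepsilon\ln z$. Let $\omega_{g,n}$ ($g\ge 0$, $n\ge 1$) be the topological recursion correlators of the spectral curve $(\mathbb P^1,x,y,B)$: $\omega_{0,1}=y\,\mathrm dx$, $\omega_{0,2}=B$, and for $2g-2+n>0$, with $I=\{2,\dots,n\}$, $$\omega_{g,n}(z_1,\boldsymbol z_I)=\sum_{a=\pm1}\mathop{\rm Res}_{z=a}K(z_1,z)\Big[\omega_{g-1,n+1}(z,\tfrac1z,\boldsymbol z_I)+\sum^{\circ}_{\substack{h+h'=g\\ J\sqcup J'=I}}\omega_{h,1+|J|}(z,\boldsymbol z_J)\,\omega_{h',1+|J'|}(\tfrac1z,\boldsymbol z_{J'})\Big],\qquad K(z_1,z)=\frac12\,\frac{\int_{1/z}^{z}\omega_{0,2}(z_1,\cdot)}{(y(z)-y(1/z))\,\mathrm dx(z)},$$ where $\circ$ means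 that the terms involving $\omega_{0,1}$ are omitted, terms of negative genus are zero, and the path of integration in $K$ is the short segment near $a$. Write $x_i=x(z_i)$, let $\mathrm d_i$ be the exterior derivative in $z_i$, and put $$\omega_{0,2}^{\rm odd}(z,w)=\tfrac12\big(\omega_{0,2}(z,w)-\omega_{0,2}(1/z,w)\big),\qquad \mathcal A[f](x_1)=\sum_{a\text{ pole of }f}\mathop{\rm Res}_{z=a}\frac{f(z)\ln z}{x_1-x(z)},$$ $$\mathcal L[f](z_1,z_i)=2\,\omega_{0,2}^{\rm odd}(z_1,z_i)\frac{f(z_1)}{\mathrm dx_1}-\mathrm d_i\Big(\frac{\mathrm dx_1}{x_1-x_i}\,\frac{f(z_i)}{\mathrm dx_i}\Big).$$ Let $z_1,\dots,z_n\in\mathbb C\setminus\{0,1,-1\}$ with $x_1\neq x_i$ for $i\in I$. **(a)** If $2g-2+n\ge 2$, then $$\mathcal A[\omega_{g,n}(\cdot,\boldsymbol z_I)](x_1)\,\mathrm dx_1=-\varepsilon\Bigg(\sum_{i=2}^n\mathcal L[\omega_{g,n-1}(\cdot,\boldsymbol z_{I\setminus\{i\}})](z_1,z_i)+\frac{\omega_{g-1,n+1}(z_1,z_1,\boldsymbol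 z_I)}{\mathrm dx_1}+\sum^{\circ\circ}_{\substack{h+h'=g\\ J\sqcup J'=I}}\frac{\omega_{h,1+|J|}(z_1,\boldsymbol z_J)\,\omega_{h',1+|J'|}(z_1,\boldsymbol z_{J'})}{\mathrm dx_1}\Bigg),$$ where $\circ\circ$ means that the terms involving $\omega_{0,1}$ or $\omega_{0,2}$ are omitted. **(b)** For $(g,n)=(0,3)$, if moreover $x_2\ne x_3$, $$\mathcal A[\omega_{0,3}(\cdot,z_2,z_3)](x_1)\,\mathrm dx_1=\varepsilon\Bigg(-\frac{2\,\omega_{0,2}^{\rm odd}(z_1,z_2)\,\omega_{0,2}^{\rm odd}(z_1,z_3)}{\mathrm dx_1}+\mathrm d_2\Big(\frac{\mathrm dx_1}{x_1-x_2}\frac{\omega_{0,2}^{\rm odd}(z_2,z_3)}{\mathrm dx_2}\Big)+\mathrm d_3\Big(\frac{\mathrm dx_1}{x_1-x_3}\frac{\omega_{0,2}^{\rm odd}(z_2,z_3)}{\mathrm dx_3}\Big)\Bigg).$$ **(c)** For $(g,n)=(1,1)$, $\displaystyle \mathcal A[\omega_{1,1}](x_1)\,\mathrm dx_1=\varepsilon\,\frac{\omega_{0,2}(z_1,1/z_1)}{\mathrm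 dx_1}.$ -/

import Mathlib

open Filter Topology

noncomputable section

namespace P1Curve

/- A multidifferential on (the affine part of) `ℙ¹` is represented throughout by its coefficient
with respect to `dz₁ ⋯ dzₙ` in the coordinate `z`, a complex-valued function. -/

/-- Residue at `a` of the 1-form `f(z) dz`: the contour integral over small circles around `a`,
divided by `2πi`. -/
def residue (f : ℂ → ℂ) (a : ℂ) : ℂ :=
  limUnder (𝓝[>] (0 : ℝ)) fun r : ℝ =>
    (2 * (Real.pi : ℂ) * Complex.I)⁻¹ * ∮ z in C(a, r), f z

/-- The logarithm with branch cut along the nonpositive imaginary axis and `ln 1 = 0`. -/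
def ln (z : ℂ) : ℂ :=
  Complex.log (-Complex.I * z) + (Real.pi : ℂ) / 2 * Complex.I

/-- The function `x(z) = z + 1/z`. -/
def x (z : ℂ) : ℂ := z + 1 / z

/-- Coefficient of `dx = (1 - 1/z²) dz`; its zeroes are the ramification points `1` and `-1`. -/
def dx (z : ℂ) : ℂ := 1 - 1 / z ^ 2

/-- The function `y = ε ln z`, so that `dy = ε dz/z`. -/
def y (ε z : ℂ) : ℂ := ε * ln z

/-- The involution `z ↦ 1/z`, which preserves `x`. -/
def inv (z : ℂ) : ℂ := 1 / z

/-- Derivative of the involution: the coefficient of `d(1/z) = -dz/z²`. -/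
def dinv (z : ℂ) : ℂ := -1 / z ^ 2

/-- Coefficient of the bidifferential `B(z,w) = dz dw / (z - w)²`. -/
def B (z w : ℂ) : ℂ := 1 / (z - w) ^ 2

/-- Coefficient (in the variable `z`) of `∫_{σ(p)}^{p} B(z, ·)`, along the segment from `σ(p)`
to `p`, where `σ(p) = 1/p`. -/
def intB (z p : ℂ) : ℂ :=
  ∫ t in (0 : ℝ)..1, B z (inv p + (t : ℂ) * (p - inv p)) * (p - inv p)

/-- Coefficient (of `dz / dp`) of the recursion kernel
`K(z,p) = (1/2) ∫_{σ(p)}^{p} B(z, ·) / ((y(p) - y(σ(p))) dx(p))`. -/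
def kernel (ε z p : ℂ) : ℂ :=
  1 / 2 * intB z p / ((y ε p - y ε (inv p)) * dx p)

/-- The family `z_J` of the variables with index in `J`, in increasing order of the index. -/
def sub {m : ℕ} (z : Fin m → ℂ) (J : Finset (Fin m)) : Fin J.card → ℂ :=
  fun k => z (J.orderEmbOfFin rfl k)

/-- `corr ε g m p z` is the coefficient of the topological recursion correlator
`ω_{g,1+m}(p, z₁, …, z_m)` of the spectral curve `(ℙ¹, x = z + 1/z, y = ε ln z, B)`.
The factor `dinv q` comes from the one argument that is `σ(q)`; in the sum over
`h + h' = g`, `J ⊔ J' = I` the terms that involve `ω_{0,1}` are omitted. -/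
def corr (ε : ℂ) (g m : ℕ) (p : ℂ) (z : Fin m → ℂ) : ℂ :=
  if g = 0 ∧ m = 0 then y ε p * dx p
  else if h02 : g = 0 ∧ m = 1 then B p (z ⟨0, by omega⟩)
  else
    let integrand : ℂ → ℂ := fun q =>
      kernel ε p q * dinv q *
        ((if _hg : g = 0 then 0 else corr ε (g - 1) (m + 1) q (Fin.cons (inv q) z)) +
          ∑ h : Fin (g + 1), ∑ J : Finset (Fin m),
            if _hJ : ((h : ℕ) = 0 ∧ J.card = 0) ∨ (g - (h : ℕ) = 0 ∧ Jᶜ.card = 0) then 0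
            else corr ε h J.card q (sub z J) * corr ε (g - h) Jᶜ.card (inv q) (sub z Jᶜ))
    residue integrand 1 + residue integrand (-1)
termination_by 2 * g + m
decreasing_by
  · omega
  · have h1 := J.card_le_univ
    have h2 := J.card_compl
    have h3 := h.2
    simp only [Fintype.card_fin] at h1 h2
    omega
  · have h1 := J.card_le_univ
    have h2 := J.card_compl
    have h3 := h.2
    simp only [Fintype.card_fin] at h1 h2
    omega

/-- `𝒜[f](x₁)`: the sum over the poles `a` of the 1-form `f` of the residues at `a` of
`f(z) ln z / (x₁ - x(z))`. (Since `ln` is not meromorphic at infinity, this is meant for 1-forms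
without a pole there.) -/
def opA (f : ℂ → ℂ) (x₁ : ℂ) : ℂ :=
  ∑ᶠ (a : ℂ) (_ : meromorphicOrderAt f a < 0), residue (fun z => f z * ln z / (x₁ - x z)) a

/-- Coefficient of `ω_{0,2}^{odd}(z,w) = (ω_{0,2}(z,w) - ω_{0,2}(1/z,w)) / 2`. -/
def Bodd (z w : ℂ) : ℂ := 1 / 2 * (B z w - B (inv z) w * dinv z)

/-- `dTerm F z₁ w` is the coefficient of `d_w ( dx₁ / (x₁ - x(w)) · F(w) / dx(w) )`, where
`x₁ = x(z₁)`. -/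
def dTerm (F : ℂ → ℂ) (z₁ w : ℂ) : ℂ :=
  deriv (fun u => dx z₁ / (x z₁ - x u) * (F u / dx u)) w

/-- Coefficient of
`ℒ[f](z₁,w) = 2 ω_{0,2}^{odd}(z₁,w) f(z₁)/dx₁ - d_w ( dx₁ / (x₁ - x(w)) · f(w)/dx(w) )`. -/
def opL (f : ℂ → ℂ) (z₁ w : ℂ) : ℂ :=
  2 * Bodd z₁ w * (f z₁ / dx z₁) - dTerm f z₁ w

/-- Generic point: not `0`, and not one of the ramification points `1`, `-1`. -/
def Generic (z : ℂ) : Prop := z ≠ 0 ∧ z ≠ 1 ∧ z ≠ -1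

/-- `x(z) ≠ x(w)`, for nonzero `z`, `w`. -/
def Apart (z w : ℂ) : Prop := z ≠ w ∧ z * w ≠ 1

end P1Curve

end

/-!
# The operator `𝒜` applied to the correlators of the curve `x = z + 1/z`, `y = ε ln z`

Write `Δy(q) = y(q) - y(1/q)`. Near a ramification point `a = ±1` the kernel is
`½ (1/(p - q) - 1/(p - 1/q)) / (Δy dx)(q)`, and the bracket it multiplies is, in all stable cases,
an even quadratic differential `-N(q, z)`. The residue at `a` is unchanged by `q ↦ 1/q`, so the
recursion says that `ω_{g,n}(p, z)` is minus the sum of the principal parts at `±1`, in `p`, of the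
odd form `N / (Δy dx)` (`corr_eq_pp`, `corr_eq_pp_num`). Here `N` is, up to sign and after replacing
`1/q` by `q`, the bracket of the recursion, with the two terms containing `ω_{0,2}(·, zᵢ)` merged
into `2 ω_{0,2}^{odd}(q, zᵢ) ω_{g,n-1}(q, …)`. For `ω_{0,3}` the product of the even parts of `B`
drops out, because it vanishes to the order of `Δy dx` (`corr_zero_two`); for
`ω_{1,1}` one has `N = 1/(q² - 1)²` (`corr_one_zero`).

That `1/q` may be replaced by `q` in every argument needs the oddness of the correlators in all of
their variables; and taking residues of `ω_{g-1,n+1}(q, 1/q, z)` needs their joint dependence on the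
variables to be tame. Both come from `isStableForm`: a stable correlator is a finite sum of products
of odd forms in one variable, holomorphic away from `±1`. The induction rests on the expansion
`oddB_expansion` of `ω_{0,2}^{odd}(q, w)` at `q = ±1` into products of such forms.

For the operator `𝒜`, the logarithm may be replaced by its odd part `Δy / (2ε)`, which cancels the
denominator of `N / (Δy dx)`; what remains is the sum of the residues at `±1` of the rational form
`N / (dx (x₁ - x))` (`residue_mul_ln`, `opA_corr`). By the residue theorem on the sphere
(`sum_residue_eq_zero`, from Liouville's theorem) these residues are moved to `z₁` and `1/z₁`, which
give `N(z₁)/dx₁`, and to the double poles `zᵢ` and `1/zᵢ` of `ω_{0,2}^{odd}(·, zᵢ)`, which give the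
derivatives `dᵢ` (`sum_residue_mul_cauchyFactor`).
-/

noncomputable section

namespace P1Curve


/-! ### Residues as eventually constant circle integrals -/

/-- The form `f(z) dz` is integrable on all small circles around `a`, and its integral over each
of them is `2πi c`. -/
def HasRes (f : ℂ → ℂ) (a c : ℂ) : Prop :=
  ∀ᶠ r in 𝓝[>] (0 : ℝ), CircleIntegrable f a r ∧
    (2 * (Real.pi : ℂ) * Complex.I)⁻¹ * (∮ z in C(a, r), f z) = c

theorem eventually_forall_sphere {a : ℂ} {p : ℂ → Prop} (h : ∀ᶠ z in 𝓝[≠] a, p z) :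
    ∀ᶠ r in 𝓝[>] (0 : ℝ), ∀ z ∈ Metric.sphere a r, p z := by
  rw [eventually_nhdsWithin_iff, Metric.eventually_nhds_iff] at h
  obtain ⟨δ, hδ, h⟩ := h
  filter_upwards [Ioo_mem_nhdsGT hδ] with r hr z hz
  have hz' : dist z a = r := hz
  refine h (by rw [hz']; exact hr.2) ?_
  rintro rfl
  have := hr.1
  simp at hz'
  linarith

theorem HasRes.residue_eq {f : ℂ → ℂ} {a c : ℂ} (h : HasRes f a c) : residue f a = c :=
  (tendsto_const_nhds.congr' (h.mono fun _ hr => hr.2.symm)).limUnder_eq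

theorem HasRes.congr {f g : ℂ → ℂ} {a c : ℂ} (h : HasRes f a c) (hfg : f =ᶠ[𝓝[≠] a] g) :
    HasRes g a c := by
  filter_upwards [h, eventually_forall_sphere hfg, self_mem_nhdsWithin] with r hr h2 hr0
  have hr0' : (0 : ℝ) < r := hr0
  rw [← circleIntegral.integral_congr hr0'.le h2]
  refine ⟨(circleIntegrable_congr ?_).1 hr.1, hr.2⟩
  rw [abs_of_pos hr0']
  exact h2

theorem residue_congr {f g : ℂ → ℂ} {a : ℂ} (hfg : f =ᶠ[𝓝[≠] a] g) :
    residue f a = residue g a := by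
  unfold residue limUnder
  congr 1
  refine Filter.map_congr ?_
  filter_upwards [eventually_forall_sphere hfg, self_mem_nhdsWithin] with r h2 hr0
  rw [circleIntegral.integral_congr (le_of_lt hr0) h2]

theorem HasRes.add {f g : ℂ → ℂ} {a c d : ℂ} (hf : HasRes f a c) (hg : HasRes g a d) :
    HasRes (fun z => f z + g z) a (c + d) := by
  filter_upwards [hf, hg] with r h1 h2
  refine ⟨h1.1.add h2.1, ?_⟩
  rw [circleIntegral.integral_add h1.1 h2.1, mul_add, h1.2, h2.2]

theorem HasRes.const_mul {f : ℂ → ℂ} {a c : ℂ} (hf : HasRes f a c) (k : ℂ) :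
    HasRes (fun z => k * f z) a (k * c) := by
  filter_upwards [hf] with r h1
  refine ⟨h1.1.const_smul (a := k), ?_⟩
  rw [circleIntegral.integral_const_mul, ← h1.2]
  ring

theorem hasRes_zero (a : ℂ) : HasRes (fun _ => 0) a 0 := by
  filter_upwards with r
  refine ⟨circleIntegrable_const _ _ _, ?_⟩
  simp [circleIntegral]

theorem HasRes.sum {ι : Type*} {s : Finset ι} {f : ι → ℂ → ℂ} {a : ℂ} {c : ι → ℂ}
    (h : ∀ i ∈ s, HasRes (f i) a (c i)) : HasRes (fun z => ∑ i ∈ s, f i z) a (∑ i ∈ s, c i) := by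
  classical
  induction s using Finset.induction_on with
  | empty => simpa using hasRes_zero a
  | insert i s hi ih =>
    simp only [Finset.sum_insert hi]
    exact (h i (by simp)).add (ih fun j hj => h j (by simp [hj]))

/-- The residue of an exact form vanishes. -/
theorem hasRes_deriv {f F : ℂ → ℂ} {a : ℂ} (hf : ∀ᶠ z in 𝓝[≠] a, ContinuousAt f z)
    (hF : ∀ᶠ z in 𝓝[≠] a, HasDerivAt F (f z) z) : HasRes f a 0 := by
  filter_upwards [eventually_forall_sphere hf, eventually_forall_sphere hF,
    self_mem_nhdsWithin] with r h1 h2 hr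
  refine ⟨ContinuousOn.circleIntegrable (le_of_lt hr)
    fun z hz => (h1 z hz).continuousWithinAt, ?_⟩
  rw [circleIntegral.integral_eq_zero_of_hasDerivWithinAt (le_of_lt hr)
    fun z hz => (h2 z hz).hasDerivWithinAt, mul_zero]

theorem _root_.AnalyticAt.hasRes {f : ℂ → ℂ} {a : ℂ} (hf : AnalyticAt ℂ f a) : HasRes f a 0 := by
  have h := hf.eventually_analyticAt
  rw [Metric.eventually_nhds_iff] at h
  obtain ⟨δ, hδ, h⟩ := h
  filter_upwards [Ioo_mem_nhdsGT hδ] with r hr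
  have h' : ∀ z ∈ Metric.closedBall a r, AnalyticAt ℂ f z :=
    fun z hz => h (lt_of_le_of_lt hz hr.2)
  refine ⟨ContinuousOn.circleIntegrable hr.1.le fun z hz =>
    (h' z (Metric.sphere_subset_closedBall hz)).continuousAt.continuousWithinAt, ?_⟩
  rw [Complex.circleIntegral_eq_zero_of_differentiable_on_off_countable hr.1.le
    Set.countable_empty (fun z hz => (h' z hz).continuousAt.continuousWithinAt)
    (fun z hz => (h' z (Metric.ball_subset_closedBall hz.1)).differentiableAt), mul_zero]

theorem hasRes_sub_inv (a : ℂ) : HasRes (fun z => (z - a)⁻¹) a 1 := by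
  filter_upwards [self_mem_nhdsWithin] with r hr
  have hr' : r ≠ 0 := ne_of_gt hr
  refine ⟨circleIntegrable_sub_inv_iff.2 (Or.inr fun h => hr' (by simpa [eq_comm] using h)), ?_⟩
  rw [circleIntegral.integral_sub_center_inv a hr']
  exact inv_mul_cancel₀ Complex.two_pi_I_ne_zero

theorem eventually_ne_punctured (a b : ℂ) : ∀ᶠ z in 𝓝[≠] a, z ≠ b := by
  by_cases h : a = b
  · subst h
    exact self_mem_nhdsWithin
  · exact (isOpen_ne.mem_nhds h : {z | z ≠ b} ∈ 𝓝 a) |> mem_nhdsWithin_of_mem_nhds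

theorem hasRes_sub_pow_inv (a : ℂ) (k : ℕ) :
    HasRes (fun z => ((z - a) ^ (k + 2))⁻¹) a 0 := by
  refine hasRes_deriv (F := fun z => -((k : ℂ) + 1)⁻¹ * ((z - a) ^ (k + 1))⁻¹) ?_ ?_
  · filter_upwards [eventually_ne_punctured a a] with z hz
    have : z - a ≠ 0 := sub_ne_zero.2 hz
    fun_prop (disch := positivity)
  · filter_upwards [eventually_ne_punctured a a] with z hz
    have h : z - a ≠ 0 := sub_ne_zero.2 hz
    have h1 : (k : ℂ) + 1 ≠ 0 := by exact_mod_cast k.succ_ne_zero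
    have := ((((hasDerivAt_id z).sub_const a).pow (k + 1)).inv (pow_ne_zero _ h)).const_mul
      (-((k : ℂ) + 1)⁻¹)
    refine this.congr_deriv ?_
    simp
    field_simp
    ring

/-! ### Laurent expansions -/

theorem _root_.AnalyticAt.exists_eq_add_sub_mul {h : ℂ → ℂ} {a : ℂ} (hh : AnalyticAt ℂ h a) :
    ∃ g : ℂ → ℂ, AnalyticAt ℂ g a ∧ ∀ z, h z = h a + (z - a) * g z := by
  refine ⟨dslope h a, ?_, fun z => ?_⟩
  · obtain ⟨p, hp⟩ := hh
    exact ⟨_, hp.has_fpower_series_dslope_fslope⟩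
  · have := sub_smul_dslope h a z
    rw [smul_eq_mul] at this
    rw [this]
    ring

theorem exists_laurent_of_pow_mul {a : ℂ} (n : ℕ) : ∀ f h : ℂ → ℂ, AnalyticAt ℂ h a →
    (∀ z, z ≠ a → (z - a) ^ n * f z = h z) →
    ∃ (c : ℕ → ℂ) (g : ℂ → ℂ), AnalyticAt ℂ g a ∧
      ∀ z, z ≠ a → f z = ∑ k ∈ Finset.range n, c k * ((z - a) ^ (k + 1))⁻¹ + g z := by
  induction n with
  | zero => exact fun f h hh hf => ⟨0, h, hh, fun z hz => by simpa using hf z hz⟩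
  | succ n ih =>
    intro f h hh hf
    obtain ⟨h1, hh1, hh2⟩ := hh.exists_eq_add_sub_mul
    obtain ⟨c, g, hg, hc⟩ := ih (fun z => f z - h a * ((z - a) ^ (n + 1))⁻¹) h1 hh1 (by
      intro z hz
      have hz' : z - a ≠ 0 := sub_ne_zero.2 hz
      have h3 := hf z hz
      rw [hh2 z] at h3
      have : (z - a) * ((z - a) ^ n * (f z - h a * ((z - a) ^ (n + 1))⁻¹)) = (z - a) * h1 z := by
        rw [mul_sub, mul_sub]
        have e : (z - a) * ((z - a) ^ n * f z) = (z - a) ^ (n + 1) * f z := by ring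
        rw [e, h3]
        field_simp
        ring
      exact mul_left_cancel₀ hz' this)
    refine ⟨fun k => if k = n then h a else c k, g, hg, fun z hz => ?_⟩
    have h4 := hc z hz
    simp only [Finset.sum_range_succ, if_true]
    rw [Finset.sum_congr rfl (g := fun k =>
      c k * ((z - a) ^ (k + 1))⁻¹) (fun k hk => by
        rw [if_neg (ne_of_lt (Finset.mem_range.1 hk))])]
    linear_combination h4

/-- A meromorphic function is a finite principal part plus an analytic function. -/
theorem _root_.MeromorphicAt.exists_laurent {f : ℂ → ℂ} {a : ℂ} (hf : MeromorphicAt f a) :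
    ∃ (n : ℕ) (c : ℕ → ℂ) (g : ℂ → ℂ), AnalyticAt ℂ g a ∧
      ∀ z, z ≠ a → f z = ∑ k ∈ Finset.range n, c k * ((z - a) ^ (k + 1))⁻¹ + g z := by
  obtain ⟨n, hn⟩ := hf
  exact ⟨n, exists_laurent_of_pow_mul n f _ hn fun z _ => by simp⟩

/-- The coefficient of `(z - a)⁻¹` in a finite principal part. -/
def headCoeff (n : ℕ) (c : ℕ → ℂ) : ℂ := if 0 < n then c 0 else 0

theorem hasRes_principal (a : ℂ) (n : ℕ) (c : ℕ → ℂ) :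
    HasRes (fun z => ∑ k ∈ Finset.range n, c k * ((z - a) ^ (k + 1))⁻¹) a (headCoeff n c) := by
  have h : headCoeff n c = ∑ k ∈ Finset.range n, c k * (if k = 0 then 1 else 0) := by
    simp [headCoeff]
  rw [h]
  refine HasRes.sum fun k _ => HasRes.const_mul ?_ _
  cases k with
  | zero => simpa using hasRes_sub_inv a
  | succ k => simpa using hasRes_sub_pow_inv a k

theorem _root_.MeromorphicAt.hasRes {f : ℂ → ℂ} {a : ℂ} (hf : MeromorphicAt f a) :
    HasRes f a (residue f a) := by
  obtain ⟨n, c, g, hg, h⟩ := hf.exists_laurent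
  have h1 : HasRes f a (headCoeff n c + 0) :=
    ((hasRes_principal a n c).add hg.hasRes).congr
      ((eventually_ne_punctured a a).mono fun z hz => (h z hz).symm)
  rwa [h1.residue_eq]

theorem _root_.AnalyticAt.residue_eq_zero {f : ℂ → ℂ} {a : ℂ} (hf : AnalyticAt ℂ f a) :
    residue f a = 0 := hf.hasRes.residue_eq

theorem residue_add {f g : ℂ → ℂ} {a : ℂ} (hf : MeromorphicAt f a) (hg : MeromorphicAt g a) :
    residue (fun z => f z + g z) a = residue f a + residue g a :=
  (hf.hasRes.add hg.hasRes).residue_eq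

theorem residue_const_mul {f : ℂ → ℂ} {a : ℂ} (hf : MeromorphicAt f a) (k : ℂ) :
    residue (fun z => k * f z) a = k * residue f a :=
  (hf.hasRes.const_mul k).residue_eq

theorem residue_sum {ι : Type*} {s : Finset ι} {f : ι → ℂ → ℂ} {a : ℂ}
    (h : ∀ i ∈ s, MeromorphicAt (f i) a) :
    residue (fun z => ∑ i ∈ s, f i z) a = ∑ i ∈ s, residue (f i) a :=
  (HasRes.sum fun i hi => (h i hi).hasRes).residue_eq

theorem residue_zero (a : ℂ) : residue (fun _ => 0) a = 0 := (hasRes_zero a).residue_eq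

theorem residue_simple {g : ℂ → ℂ} {a : ℂ} (hg : AnalyticAt ℂ g a) :
    residue (fun z => g z / (z - a)) a = g a := by
  obtain ⟨h, hh, e⟩ := hg.exists_eq_add_sub_mul
  have h1 : HasRes (fun z => g z / (z - a)) a (g a * 1 + 0) := by
    refine (((hasRes_sub_inv a).const_mul (g a)).add hh.hasRes).congr ?_
    filter_upwards [eventually_ne_punctured a a] with z hz
    have : z - a ≠ 0 := sub_ne_zero.2 hz
    rw [e z]
    field_simp
  simpa using h1.residue_eq

theorem residue_double {g : ℂ → ℂ} {a : ℂ} (hg : AnalyticAt ℂ g a) :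
    residue (fun z => g z / (z - a) ^ 2) a = deriv g a := by
  obtain ⟨h, hh, e⟩ := hg.exists_eq_add_sub_mul
  have hd : deriv g a = h a := by
    have : HasDerivAt (fun z => g a + (z - a) * h z) (h a) a := by
      have := ((((hasDerivAt_id a).sub_const a).mul
        hh.differentiableAt.hasDerivAt).const_add (g a))
      refine this.congr_deriv ?_
      simp
    rw [← this.deriv]
    exact congrArg (fun F => deriv F a) (funext e)
  have hm : MeromorphicAt (fun z => h z / (z - a)) a := by
    have := hh.meromorphicAt
    fun_prop
  have h1 : HasRes (fun z => g z / (z - a) ^ 2) a (g a * 0 + h a) := by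
    rw [← residue_simple hh]
    refine (((hasRes_sub_pow_inv a 0).const_mul (g a)).add hm.hasRes).congr ?_
    filter_upwards [eventually_ne_punctured a a] with z hz
    have : z - a ≠ 0 := sub_ne_zero.2 hz
    rw [e z]
    field_simp
    ring
  rw [h1.residue_eq, hd]
  simp

/-! ### Principal parts -/

/-- The principal part of `f` at `a`, evaluated at `p`. -/
def pp (a : ℂ) (f : ℂ → ℂ) (p : ℂ) : ℂ := residue (fun q => f q / (p - q)) a

theorem _root_.MeromorphicAt.div_sub {f : ℂ → ℂ} {a : ℂ} (hf : MeromorphicAt f a) (p : ℂ) :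
    MeromorphicAt (fun q => f q / (p - q)) a := by fun_prop

/-- The principal part of `(q - a)^(-k-1)` is that function itself. -/
theorem hasRes_pow_inv_div {a p : ℂ} (hp : p ≠ a) (k : ℕ) :
    HasRes (fun q => ((q - a) ^ (k + 1))⁻¹ / (p - q)) a ((p - a) ^ (k + 1))⁻¹ := by
  have hpa : p - a ≠ 0 := sub_ne_zero.2 hp
  have hne : ∀ᶠ z in 𝓝[≠] a, z - a ≠ 0 ∧ p - z ≠ 0 :=
    ((eventually_ne_punctured a a).and (eventually_ne_punctured a p)).mono fun z hz =>
      ⟨sub_ne_zero.2 hz.1, sub_ne_zero.2 hz.2.symm⟩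
  induction k with
  | zero =>
    have h0 : AnalyticAt ℂ (fun q => 1 / (p - q)) a := by fun_prop (disch := assumption)
    have h1 := ((hasRes_sub_inv a).add h0.hasRes).const_mul (p - a)⁻¹
    rw [add_zero, mul_one] at h1
    rw [zero_add, pow_one]
    refine h1.congr (hne.mono fun z hz => ?_)
    have := hz.1
    have := hz.2
    simp only
    field_simp
    ring
  | succ k ih =>
    have h1 := ((hasRes_sub_pow_inv a k).add ih).const_mul (p - a)⁻¹
    have e : (p - a)⁻¹ * (0 + ((p - a) ^ (k + 1))⁻¹) = ((p - a) ^ (k + 1 + 1))⁻¹ := by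
      field_simp
      ring
    rw [e] at h1
    refine h1.congr (hne.mono fun z hz => ?_)
    have := hz.1
    have := hz.2
    simp only
    field_simp
    ring

theorem pp_eq_of_laurent {f : ℂ → ℂ} {a : ℂ} {n : ℕ} {c : ℕ → ℂ} {g : ℂ → ℂ}
    (hg : AnalyticAt ℂ g a)
    (h : ∀ z, z ≠ a → f z = ∑ k ∈ Finset.range n, c k * ((z - a) ^ (k + 1))⁻¹ + g z)
    {p : ℂ} (hp : p ≠ a) :
    pp a f p = ∑ k ∈ Finset.range n, c k * ((p - a) ^ (k + 1))⁻¹ := by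
  have hpa : p - a ≠ 0 := sub_ne_zero.2 hp
  have h0 : AnalyticAt ℂ (fun q => g q / (p - q)) a := by fun_prop (disch := assumption)
  have h1 : HasRes (fun q => f q / (p - q)) a
      (∑ k ∈ Finset.range n, c k * ((p - a) ^ (k + 1))⁻¹ + 0) := by
    refine ((HasRes.sum fun k _ => (hasRes_pow_inv_div hp k).const_mul (c k)).add
      h0.hasRes).congr ?_
    filter_upwards [eventually_ne_punctured a a] with z hz
    rw [h z hz, add_div, Finset.sum_div]
    simp only [mul_div_assoc]
  rw [pp, h1.residue_eq, add_zero]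

theorem residue_eq_of_laurent {f : ℂ → ℂ} {a : ℂ} {n : ℕ} {c : ℕ → ℂ} {g : ℂ → ℂ}
    (hg : AnalyticAt ℂ g a)
    (h : ∀ z, z ≠ a → f z = ∑ k ∈ Finset.range n, c k * ((z - a) ^ (k + 1))⁻¹ + g z) :
    residue f a = headCoeff n c := by
  have h1 : HasRes f a (headCoeff n c + 0) :=
    ((hasRes_principal a n c).add hg.hasRes).congr
      ((eventually_ne_punctured a a).mono fun z hz => (h z hz).symm)
  rw [h1.residue_eq, add_zero]

theorem pp_analyticAt {f : ℂ → ℂ} {a : ℂ} (hf : MeromorphicAt f a) {p : ℂ} (hp : p ≠ a) :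
    AnalyticAt ℂ (pp a f) p := by
  obtain ⟨n, c, g, hg, h⟩ := hf.exists_laurent
  have h1 : AnalyticAt ℂ (fun p => ∑ k ∈ Finset.range n, c k * ((p - a) ^ (k + 1))⁻¹) p := by
    refine Finset.analyticAt_fun_sum _ fun k _ => ?_
    have : p - a ≠ 0 := sub_ne_zero.2 hp
    fun_prop (disch := positivity)
  refine h1.congr ?_
  filter_upwards [isOpen_ne.mem_nhds hp] with q hq
  exact (pp_eq_of_laurent hg h hq).symm

theorem pp_meromorphicAt {f : ℂ → ℂ} {a : ℂ} (hf : MeromorphicAt f a) :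
    MeromorphicAt (pp a f) a := by
  obtain ⟨n, c, g, hg, h⟩ := hf.exists_laurent
  have h1 : MeromorphicAt (fun p => ∑ k ∈ Finset.range n, c k * ((p - a) ^ (k + 1))⁻¹) a := by
    refine MeromorphicAt.fun_sum fun k _ => ?_
    fun_prop
  refine h1.congr ?_
  filter_upwards [eventually_ne_punctured a a] with q hq
  exact (pp_eq_of_laurent hg h hq).symm

/-- A meromorphic function differs from its principal part by an analytic function. -/
theorem exists_eq_pp_add {f : ℂ → ℂ} {a : ℂ} (hf : MeromorphicAt f a) :
    ∃ g, AnalyticAt ℂ g a ∧ ∀ z, z ≠ a → f z = pp a f z + g z := by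
  obtain ⟨n, c, g, hg, h⟩ := hf.exists_laurent
  exact ⟨g, hg, fun z hz => by rw [pp_eq_of_laurent hg h hz, h z hz]⟩

/-- The residue is the leading coefficient of the principal part at infinity. -/
theorem tendsto_mul_pp {f : ℂ → ℂ} {a : ℂ} (hf : MeromorphicAt f a) :
    Tendsto (fun z => z * pp a f z) (cocompact ℂ) (𝓝 (residue f a)) := by
  obtain ⟨n, c, g, hg, h⟩ := hf.exists_laurent
  rw [residue_eq_of_laurent hg h]
  have hinv : Tendsto (fun z : ℂ => (z - a)⁻¹) (cocompact ℂ) (𝓝 0) :=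
    tendsto_inv₀_cobounded.comp (by
      rw [← Metric.cobounded_eq_cocompact]
      exact tendsto_sub_const_cobounded a)
  have h1 : Tendsto
      (fun z : ℂ => ∑ k ∈ Finset.range n, c k * ((z - a)⁻¹ ^ k * (1 + a * (z - a)⁻¹)))
      (cocompact ℂ) (𝓝 (∑ k ∈ Finset.range n, c k * (0 ^ k * (1 + a * 0)))) := by
    refine tendsto_finsetSum _ fun k _ => ?_
    exact ((hinv.pow k).mul ((hinv.const_mul a).const_add 1)).const_mul (c k)
  have e : headCoeff n c = ∑ k ∈ Finset.range n, c k * (0 ^ k * (1 + a * 0)) := by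
    simp [headCoeff, zero_pow_eq]
  rw [e]
  refine h1.congr' ?_
  have hne : ∀ᶠ z in cocompact ℂ, z ≠ a := by
    have : ({a} : Set ℂ)ᶜ ∈ cocompact ℂ := isCompact_singleton.compl_mem_cocompact
    exact this
  filter_upwards [hne] with z hz
  rw [pp_eq_of_laurent hg h hz, Finset.mul_sum]
  refine Finset.sum_congr rfl fun k _ => ?_
  have : z - a ≠ 0 := sub_ne_zero.2 hz
  rw [inv_pow]
  field_simp
  ring

/-- The residue theorem on the Riemann sphere, for a form without residue at infinity: by
Liouville's theorem such a form is the sum of its principal parts. -/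
theorem sum_residue_eq_zero {f : ℂ → ℂ} {S : Finset ℂ} (hS : ∀ a ∈ S, MeromorphicAt f a)
    (hf : ∀ z, z ∉ S → AnalyticAt ℂ f z)
    (hinf : Tendsto (fun z => z * f z) (cocompact ℂ) (𝓝 0)) :
    ∑ a ∈ S, residue f a = 0 := by
  -- at every point, `f` minus the sum of its principal parts has a removable singularity
  have hh : ∀ w, ∃ g, AnalyticAt ℂ g w ∧
      ∀ᶠ z in 𝓝[≠] w, f z - ∑ a ∈ S, pp a f z = g z := by
    intro w
    by_cases hw : w ∈ S
    · obtain ⟨g, hg, h⟩ := exists_eq_pp_add (hS w hw)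
      refine ⟨fun z => g z - ∑ a ∈ S.erase w, pp a f z, hg.fun_sub
        (Finset.analyticAt_fun_sum _ fun a ha =>
          pp_analyticAt (hS a (Finset.mem_of_mem_erase ha)) (Finset.ne_of_mem_erase ha).symm), ?_⟩
      filter_upwards [eventually_ne_punctured w w] with z hz
      rw [← Finset.add_sum_erase _ _ hw, h z hz]
      ring
    · refine ⟨_, (hf w hw).fun_sub (Finset.analyticAt_fun_sum _ fun a ha =>
          pp_analyticAt (hS a ha) fun h => hw (h ▸ ha)), Eventually.of_forall fun z => rfl⟩
  choose G hG hGe using hh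
  -- so `z ↦ G z z`, the value at `z` of the extension at `z`, is entire
  have hEa : ∀ w, AnalyticAt ℂ (fun z => G z z) w := by
    intro w
    refine (hG w).congr ?_
    have h1 : ∀ᶠ z in 𝓝[≠] w, G w z = G z z := by
      filter_upwards [eventually_eventually_nhdsWithin.2 (hGe w),
        (hG w).eventually_analyticAt.filter_mono nhdsWithin_le_nhds,
        eventually_ne_punctured w w] with z hz hz2 hzw
      have h3 : ∀ᶠ u in 𝓝[≠] z, G w u = G z u := by
        have : ∀ᶠ u in 𝓝[≠] z, f u - ∑ a ∈ S, pp a f u = G w u := by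
          have : ∀ᶠ u in 𝓝 z, f u - ∑ a ∈ S, pp a f u = G w u := by
            rwa [isOpen_compl_singleton.nhdsWithin_eq hzw] at hz
          exact this.filter_mono nhdsWithin_le_nhds
        filter_upwards [this, hGe z] with u h1 h2
        rw [← h1, h2]
      have h6 : Tendsto (G w) (𝓝[≠] z) (𝓝 (G w z)) :=
        hz2.continuousAt.tendsto.mono_left nhdsWithin_le_nhds
      have h7 : Tendsto (G z) (𝓝[≠] z) (𝓝 (G z z)) :=
        (hG z).continuousAt.tendsto.mono_left nhdsWithin_le_nhds
      exact tendsto_nhds_unique (h6.congr' h3) h7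
    rw [eventually_nhdsWithin_iff] at h1
    filter_upwards [h1] with z hz
    by_cases hzw : z = w
    · rw [hzw]
    · exact hz hzw
  have hE : ∀ z, z ∉ S → G z z = f z - ∑ a ∈ S, pp a f z := by
    intro z hz
    have h1 : ContinuousAt (fun z => f z - ∑ a ∈ S, pp a f z) z :=
      ((hf z hz).fun_sub (Finset.analyticAt_fun_sum _ fun a ha =>
          pp_analyticAt (hS a ha) fun h => hz (h ▸ ha))).continuousAt
    have h7 : Tendsto (G z) (𝓝[≠] z) (𝓝 (G z z)) :=
        (hG z).continuousAt.tendsto.mono_left nhdsWithin_le_nhds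
    exact tendsto_nhds_unique h7 ((h1.tendsto.mono_left nhdsWithin_le_nhds).congr' (hGe z))
  have hSc : ∀ᶠ z in cocompact ℂ, z ∉ S := S.finite_toSet.isCompact.compl_mem_cocompact
  have hinf2 : Tendsto (fun z => z * G z z) (cocompact ℂ) (𝓝 (0 - ∑ a ∈ S, residue f a)) := by
    refine (hinf.sub (tendsto_finsetSum S fun a ha => tendsto_mul_pp (hS a ha))).congr' ?_
    filter_upwards [hSc] with z hz
    rw [hE z hz, mul_sub, Finset.mul_sum]
  have hinv : Tendsto (fun z : ℂ => z⁻¹) (cocompact ℂ) (𝓝 0) := by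
    rw [← Metric.cobounded_eq_cocompact]
    exact tendsto_inv₀_cobounded
  have h0 : Tendsto (fun z => G z z) (cocompact ℂ) (𝓝 0) := by
    have := hinv.mul hinf2
    rw [zero_mul] at this
    refine this.congr' ?_
    have hne : ∀ᶠ z in cocompact ℂ, z ≠ (0 : ℂ) := isCompact_singleton.compl_mem_cocompact
    filter_upwards [hne] with z hz
    field_simp
  have hzero : ∀ z, G z z = 0 := fun z =>
    Differentiable.apply_eq_of_tendsto_cocompact (f := fun z => G z z)
      (fun w => (hEa w).differentiableAt) z h0
  simp only [hzero, mul_zero] at hinf2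
  have := tendsto_nhds_unique hinf2 tendsto_const_nhds
  linear_combination -this

/-! ### Residues and the involution `z ↦ 1/z` -/

/-- Residues are invariant under pull-back by `z ↦ 1/z`. -/
theorem residue_inv {f : ℂ → ℂ} {a : ℂ} (ha : a ≠ 0) (hf : MeromorphicAt f a⁻¹) :
    residue (fun z => f z⁻¹ * (-1 / z ^ 2)) a = residue f a⁻¹ := by
  obtain ⟨n, c, g, hg, h⟩ := hf.exists_laurent
  rw [residue_eq_of_laurent hg h]
  have hne : ∀ᶠ z in 𝓝[≠] a, z - a ≠ 0 ∧ z ≠ 0 ∧ z⁻¹ ≠ a⁻¹ :=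
    ((eventually_ne_punctured a a).and (eventually_ne_punctured a 0)).mono fun z hz =>
      ⟨sub_ne_zero.2 hz.1, hz.2, fun h => hz.1 (inv_injective h)⟩
  have hk : ∀ k : ℕ, HasRes (fun z => ((z⁻¹ - a⁻¹) ^ (k + 1))⁻¹ * (-1 / z ^ 2)) a
      (if k = 0 then 1 else 0) := by
    intro k
    cases k with
    | zero =>
      have h0 : AnalyticAt ℂ (fun z => a / z) a := by fun_prop (disch := assumption)
      have hm : MeromorphicAt (fun z => a / z / (z - a)) a := by fun_prop
      have h1 := hm.hasRes
      rw [residue_simple h0, div_self ha] at h1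
      refine h1.congr (hne.mono fun z hz => ?_)
      obtain ⟨h1, h2, h3⟩ := hz
      have h4 : z⁻¹ - a⁻¹ ≠ 0 := sub_ne_zero.2 h3
      have h5 : z⁻¹ - a⁻¹ = -(z - a) / (a * z) := by
        field_simp
        ring
      simp only [zero_add, pow_one]
      rw [h5]
      field_simp
    | succ k =>
      rw [if_neg k.succ_ne_zero]
      have hk1 : (k : ℂ) + 1 ≠ 0 := by exact_mod_cast k.succ_ne_zero
      refine hasRes_deriv (F := fun z => -((k : ℂ) + 1)⁻¹ * ((z⁻¹ - a⁻¹) ^ (k + 1))⁻¹)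
        (hne.mono fun z hz => ?_) (hne.mono fun z hz => ?_)
      · obtain ⟨h1, h2, h3⟩ := hz
        have h4 : z⁻¹ - a⁻¹ ≠ 0 := sub_ne_zero.2 h3
        fun_prop (disch := positivity)
      · obtain ⟨h1, h2, h3⟩ := hz
        have h4 : z⁻¹ - a⁻¹ ≠ 0 := sub_ne_zero.2 h3
        have := ((((hasDerivAt_inv h2).sub_const a⁻¹).pow (k + 1)).inv
          (pow_ne_zero _ h4)).const_mul (-((k : ℂ) + 1)⁻¹)
        refine this.congr_deriv ?_
        simp only [Nat.cast_add, Nat.cast_one, Nat.add_sub_cancel, Pi.pow_apply]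
        generalize z⁻¹ - a⁻¹ = u at h4
        field_simp
        ring
  have hg1 : AnalyticAt ℂ (fun z => g z⁻¹ * (-1 / z ^ 2)) a := by
    have h1 : AnalyticAt ℂ (fun z : ℂ => z⁻¹) a := analyticAt_inv ha
    have h2 : AnalyticAt ℂ (fun z => g z⁻¹) a := AnalyticAt.fun_comp hg h1
    fun_prop (disch := positivity)
  have h1 : HasRes (fun z => f z⁻¹ * (-1 / z ^ 2)) a
      (∑ k ∈ Finset.range n, c k * (if k = 0 then 1 else 0) + 0) := by
    refine ((HasRes.sum fun k _ => (hk k).const_mul (c k)).add hg1.hasRes).congr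
      (hne.mono fun z hz => ?_)
    simp only [h _ hz.2.2, add_mul, Finset.sum_mul, mul_assoc]
  rw [h1.residue_eq]
  simp [headCoeff]


/-! ### Linearity of principal parts -/

theorem _root_.MeromorphicAt.const_mul {f : ℂ → ℂ} {a : ℂ} (hf : MeromorphicAt f a) (k : ℂ) :
    MeromorphicAt (fun q => k * f q) a := (MeromorphicAt.const k a).mul hf

theorem pp_congr {f g : ℂ → ℂ} {a : ℂ} (h : f =ᶠ[𝓝[≠] a] g) (p : ℂ) : pp a f p = pp a g p :=
  residue_congr (h.mono fun q hq => by simp only [hq])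

theorem pp_add {f g : ℂ → ℂ} {a : ℂ} (hf : MeromorphicAt f a) (hg : MeromorphicAt g a) (p : ℂ) :
    pp a (fun q => f q + g q) p = pp a f p + pp a g p := by
  simp only [pp, add_div]
  exact residue_add (hf.div_sub p) (hg.div_sub p)

theorem pp_const_mul {f : ℂ → ℂ} {a : ℂ} (hf : MeromorphicAt f a) (k p : ℂ) :
    pp a (fun q => k * f q) p = k * pp a f p := by
  simp only [pp, mul_div_assoc]
  exact residue_const_mul (hf.div_sub p) k

theorem pp_sum {ι : Type*} {s : Finset ι} {f : ι → ℂ → ℂ} {a : ℂ}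
    (h : ∀ i ∈ s, MeromorphicAt (f i) a) (p : ℂ) :
    pp a (fun q => ∑ i ∈ s, f i q) p = ∑ i ∈ s, pp a (f i) p := by
  simp only [pp, Finset.sum_div]
  exact residue_sum fun i hi => (h i hi).div_sub p

theorem pp_zero (a p : ℂ) : pp a (fun _ => 0) p = 0 := by simp [pp, residue_zero]

theorem pp_of_analyticAt {g : ℂ → ℂ} {a p : ℂ} (hg : AnalyticAt ℂ g a) (hp : p ≠ a) :
    pp a g p = 0 := by
  have : p - a ≠ 0 := sub_ne_zero.2 hp
  have h0 : AnalyticAt ℂ (fun q => g q / (p - q)) a := by fun_prop (disch := assumption)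
  exact h0.residue_eq_zero

/-! ### The ramification points and the denominator of the kernel -/

theorem inv_eq_self_of_sq {a : ℂ} (ha : a ^ 2 = 1) : a⁻¹ = a :=
  inv_eq_of_mul_eq_one_left (by rw [← ha]; ring)

theorem eq_one_or_eq_neg_one_of_sq {a : ℂ} (ha : a ^ 2 = 1) : a = 1 ∨ a = -1 := by
  simpa using sq_eq_sq_iff_eq_or_eq_neg.1 (ha.trans (one_pow 2).symm)

theorem ne_zero_of_sq {a : ℂ} (ha : a ^ 2 = 1) : a ≠ 0 := by
  rintro rfl
  norm_num at ha

theorem sq_ne_one {z : ℂ} (h : Generic z) : z ^ 2 ≠ 1 := by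
  intro h1
  rcases eq_one_or_eq_neg_one_of_sq h1 with h1 | h1
  · exact h.2.1 h1
  · exact h.2.2 h1

theorem eq_or_eq_neg_of_sq {a z : ℂ} (ha : a ^ 2 = 1) (hz : z ^ 2 = 1) : z = a ∨ z = -a :=
  sq_eq_sq_iff_eq_or_eq_neg.1 (hz.trans ha.symm)

theorem eventually_sq_ne_one (a : ℂ) : ∀ᶠ z in 𝓝[≠] a, z ≠ 0 ∧ z ^ 2 ≠ 1 := by
  filter_upwards [eventually_ne_punctured a 0, eventually_ne_punctured a 1,
    eventually_ne_punctured a (-1)] with z h0 h1 h2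
  exact ⟨h0, sq_ne_one ⟨h0, h1, h2⟩⟩

theorem ln_analyticAt {a : ℂ} (ha : a ^ 2 = 1) : AnalyticAt ℂ ln a := by
  have h : -Complex.I * a ∈ Complex.slitPlane := by
    rcases eq_one_or_eq_neg_one_of_sq ha with rfl | rfl <;> simp [Complex.slitPlane]
  unfold ln
  fun_prop (disch := assumption)

theorem exp_ln {z : ℂ} (hz : z ≠ 0) : Complex.exp (ln z) = z := by
  have h : -Complex.I * z ≠ 0 := by simp [hz]
  rw [ln, Complex.exp_add, Complex.exp_log h, Complex.exp_pi_div_two_mul_I]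
  linear_combination -z * Complex.I_mul_I

theorem ln_hasDerivAt {a : ℂ} (ha : a ^ 2 = 1) : HasDerivAt ln a⁻¹ a := by
  have h : -Complex.I * a ∈ Complex.slitPlane := by
    rcases eq_one_or_eq_neg_one_of_sq ha with rfl | rfl <;> simp [Complex.slitPlane]
  have h0 := ne_zero_of_sq ha
  have h1 := ((((hasDerivAt_id a).const_mul (-Complex.I)).clog h).add_const
    ((Real.pi : ℂ) / 2 * Complex.I))
  refine h1.congr_deriv ?_
  have := Complex.I_ne_zero
  simp only [id]
  field_simp

/-- The difference `y(z) - y(1/z)`. Although `ln (1/z) ≠ -ln z` near `z = -1`, it is odd under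
`z ↦ 1/z` and vanishes at both ramification points. -/
def dy (ε z : ℂ) : ℂ := y ε z - y ε (inv z)

/-- The denominator `(y(z) - y(1/z)) dx(z)` of the recursion kernel. -/
def den (ε z : ℂ) : ℂ := dy ε z * dx z

theorem dy_inv (ε z : ℂ) : dy ε z⁻¹ = -dy ε z := by
  simp [dy, inv]

theorem dx_eq {z : ℂ} (hz : z ≠ 0) : dx z = (z ^ 2 - 1) / z ^ 2 := by
  rw [dx]
  field_simp

theorem dx_ne_zero {z : ℂ} (hz : z ≠ 0) (h : z ^ 2 ≠ 1) : dx z ≠ 0 := by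
  rw [dx_eq hz]
  exact div_ne_zero (sub_ne_zero.2 h) (pow_ne_zero _ hz)

theorem den_inv (ε : ℂ) {z : ℂ} (hz : z ≠ 0) : den ε z⁻¹ = z ^ 2 * den ε z := by
  rw [den, den, dy_inv, dx_eq hz, dx_eq (inv_ne_zero hz)]
  field_simp
  ring

/-- `y(z) = y(1/z)` forces `z = 1/z`, by exponentiating. -/
theorem dy_ne_zero {ε : ℂ} (hε : ε ≠ 0) {z : ℂ} (hz : z ≠ 0) (h : z ^ 2 ≠ 1) : dy ε z ≠ 0 := by
  rw [dy, y, y, ← mul_sub, inv, one_div]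
  refine mul_ne_zero hε fun h1 => h ?_
  have h2 := congrArg Complex.exp (sub_eq_zero.1 h1)
  rw [exp_ln hz, exp_ln (inv_ne_zero hz)] at h2
  rw [sq]
  nth_rewrite 1 [h2]
  exact inv_mul_cancel₀ hz

theorem dy_analyticAt (ε : ℂ) {a : ℂ} (ha : a ^ 2 = 1) : AnalyticAt ℂ (dy ε) a := by
  have h0 := ne_zero_of_sq ha
  have h1 : AnalyticAt ℂ inv a := by
    unfold inv
    fun_prop (disch := assumption)
  have h2 : AnalyticAt ℂ ln (inv a) := by
    rw [inv, one_div, inv_eq_self_of_sq ha]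
    exact ln_analyticAt ha
  exact (analyticAt_const.mul (ln_analyticAt ha)).sub (analyticAt_const.mul (h2.fun_comp h1))

theorem dy_hasDerivAt (ε : ℂ) {a : ℂ} (ha : a ^ 2 = 1) : HasDerivAt (dy ε) (2 * ε * a) a := by
  have h0 := ne_zero_of_sq ha
  have h1 : HasDerivAt inv (-(a ^ 2)⁻¹) a := by
    have : inv = Inv.inv := by
      funext z
      rw [inv, one_div]
    rw [this]
    exact hasDerivAt_inv h0
  have h2 : HasDerivAt ln a⁻¹ (inv a) := by
    rw [inv, one_div]
    nth_rewrite 2 [inv_eq_self_of_sq ha]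
    exact ln_hasDerivAt ha
  refine (((ln_hasDerivAt ha).const_mul ε).sub ((h2.comp a h1).const_mul ε)).congr_deriv ?_
  rw [ha, inv_eq_self_of_sq ha]
  ring

/-- The kernel denominator vanishes to order exactly two at the ramification points. -/
theorem exists_den_inv_eq {ε : ℂ} (hε : ε ≠ 0) {a : ℂ} (ha : a ^ 2 = 1) :
    ∃ u, AnalyticAt ℂ u a ∧ ∀ᶠ q in 𝓝[≠] a, (den ε q)⁻¹ = u q / (q - a) ^ 2 := by
  obtain ⟨g, hg, h⟩ := (dy_analyticAt ε ha).exists_eq_add_sub_mul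
  have h0 := ne_zero_of_sq ha
  have hya : dy ε a = 0 := by
    rw [dy, inv, one_div, inv_eq_self_of_sq ha, sub_self]
  have hga : g a ≠ 0 := by
    have h1 : HasDerivAt (fun z => dy ε a + (z - a) * g z) (g a) a := by
      have := ((((hasDerivAt_id a).sub_const a).mul
        hg.differentiableAt.hasDerivAt).const_add (dy ε a))
      refine this.congr_deriv ?_
      simp
    have h2 : (fun z => dy ε a + (z - a) * g z) = dy ε := funext fun z => (h z).symm
    rw [h2] at h1
    rw [h1.unique (dy_hasDerivAt ε ha)]
    simp [hε, h0]
  have h2a : a + a ≠ 0 := by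
    rw [← two_mul]
    exact mul_ne_zero two_ne_zero h0
  refine ⟨fun q => q ^ 2 / (g q * (q + a)), ?_, ?_⟩
  · have : g a * (a + a) ≠ 0 := mul_ne_zero hga h2a
    fun_prop (disch := assumption)
  · have hg' : ∀ᶠ q in 𝓝[≠] a, g q ≠ 0 :=
      (hg.continuousAt.eventually_ne hga).filter_mono nhdsWithin_le_nhds
    filter_upwards [hg', eventually_ne_punctured a a, eventually_ne_punctured a 0,
      eventually_ne_punctured a (-a)] with q h1 h2 h3 h4
    have h5 : q - a ≠ 0 := sub_ne_zero.2 h2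
    have h6 : q + a ≠ 0 := fun h => h4 (eq_neg_of_add_eq_zero_left h)
    have h7 : q ^ 2 - 1 = (q - a) * (q + a) := by linear_combination ha
    rw [den, dx_eq h3, h7, h q, hya]
    field_simp
    ring

theorem den_meromorphicAt {ε : ℂ} (hε : ε ≠ 0) {a : ℂ} (ha : a ^ 2 = 1) :
    MeromorphicAt (den ε) a := by
  obtain ⟨u, hu, h⟩ := exists_den_inv_eq hε ha
  have h1 : MeromorphicAt (fun q => u q / (q - a) ^ 2) a := by
    have := hu.meromorphicAt
    fun_prop
  have h2 := (h1.congr (h.mono fun _ hq => hq.symm)).inv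
  exact h2.congr (Eventually.of_forall fun q => by simp)

/-! ### Forms with poles at the ramification points -/

/-- Coefficients of the `j`-differentials `f(z) dz^j` on `ℙ¹`, written with `k = 2j`, that are
holomorphic away from `±1`, meromorphic at `±1` and, under `z ↦ 1/z`, odd for `j = 1` and even for
`j = 2`: both are expressed by `f(1/z) = z^k f(z)`. -/
def Form (k : ℕ) : Submodule ℂ (ℂ → ℂ) where
  carrier := {f | (∀ z, z ^ 2 ≠ 1 → AnalyticAt ℂ f z) ∧ (∀ a, a ^ 2 = 1 → MeromorphicAt f a) ∧
    ∀ z, z ≠ 0 → f z⁻¹ = z ^ k * f z}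
  add_mem' := by
    rintro f g ⟨h1, h2, h3⟩ ⟨h1', h2', h3'⟩
    refine ⟨fun z hz => (h1 z hz).add (h1' z hz), fun a ha => (h2 a ha).add (h2' a ha),
      fun z hz => ?_⟩
    rw [Pi.add_apply, Pi.add_apply, h3 z hz, h3' z hz]
    ring
  zero_mem' := ⟨fun z _ => analyticAt_const, fun a _ => MeromorphicAt.const 0 a, fun z _ => by simp⟩
  smul_mem' := by
    rintro c f ⟨h1, h2, h3⟩
    refine ⟨fun z hz => analyticAt_const.smul (h1 z hz), fun a ha => (h2 a ha).const_smul c,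
      fun z hz => ?_⟩
    simp only [Pi.smul_apply, smul_eq_mul]
    rw [h3 z hz]
    ring

theorem Form.analyticAt {k : ℕ} {f : ℂ → ℂ} (hf : f ∈ Form k) {z : ℂ} (hz : z ^ 2 ≠ 1) :
    AnalyticAt ℂ f z := hf.1 z hz

theorem Form.meromorphicAt {k : ℕ} {f : ℂ → ℂ} (hf : f ∈ Form k) {a : ℂ} (ha : a ^ 2 = 1) :
    MeromorphicAt f a := hf.2.1 a ha

theorem Form.inv_eq {k : ℕ} {f : ℂ → ℂ} (hf : f ∈ Form k) {z : ℂ} (hz : z ≠ 0) :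
    f z⁻¹ = z ^ k * f z := hf.2.2 z hz

theorem Form.mul {k l : ℕ} {f g : ℂ → ℂ} (hf : f ∈ Form k) (hg : g ∈ Form l) :
    (fun q => f q * g q) ∈ Form (k + l) :=
  ⟨fun z hz => (hf.1 z hz).mul (hg.1 z hz), fun a ha => (hf.2.1 a ha).mul (hg.2.1 a ha),
    fun z hz => by
    simp only [Form.inv_eq hf hz, Form.inv_eq hg hz]
    ring⟩

/-- If the form `h(q) dq` is odd under `q ↦ 1/q`, then so is its principal part at a ramification
point: oddness forces the residue to vanish. -/
theorem pp_mem_form {h : ℂ → ℂ} {a : ℂ} (ha : a ^ 2 = 1) (hh : MeromorphicAt h a)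
    (hodd : ∀ᶠ q in 𝓝[≠] a, h q⁻¹ = q ^ 2 * h q) : pp a h ∈ Form 2 := by
  have h0 := ne_zero_of_sq ha
  have hai := inv_eq_self_of_sq ha
  refine ⟨fun z hz => pp_analyticAt hh (by rintro rfl; exact hz ha), fun b hb => ?_, fun p hp => ?_⟩
  · rcases eq_or_eq_neg_of_sq ha hb with rfl | rfl
    · exact pp_meromorphicAt hh
    · refine (pp_analyticAt hh fun h1 => h0 ?_).meromorphicAt
      exact self_eq_neg.1 h1.symm
  · by_cases hp1 : p ^ 2 = 1
    · rw [inv_eq_self_of_sq hp1, hp1, one_mul]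
    have hres : residue h a = 0 := by
      have h1 := residue_inv h0 (f := h) (by rwa [hai])
      rw [hai] at h1
      have h2 : residue (fun z => h z⁻¹ * (-1 / z ^ 2)) a = residue (fun z => (-1) * h z) a := by
        refine residue_congr ?_
        filter_upwards [hodd, eventually_ne_punctured a 0] with z hz hz0
        rw [hz]
        field_simp
      rw [h2, residue_const_mul hh] at h1
      linear_combination (-1 / 2) * h1
    have h3 := residue_inv h0 (f := fun q => h q / (p⁻¹ - q)) (by rw [hai]; exact hh.div_sub _)
    rw [hai] at h3
    rw [pp, ← h3]
    have h4 : residue (fun z => h z⁻¹ / (p⁻¹ - z⁻¹) * (-1 / z ^ 2)) a =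
        residue (fun z => (-p) * h z + p ^ 2 * (h z / (p - z))) a := by
      refine residue_congr ?_
      filter_upwards [hodd, eventually_ne_punctured a 0, eventually_ne_punctured a p]
        with z hz hz0 hzp
      have h5 : p - z ≠ 0 := sub_ne_zero.2 hzp.symm
      have h6 : p⁻¹ - z⁻¹ = -(p - z) / (p * z) := by
        field_simp
        ring
      rw [hz, h6]
      field_simp
      ring
    rw [h4, residue_add (by fun_prop) (by fun_prop), residue_const_mul hh,
      residue_const_mul (hh.div_sub p), hres, pp]
    ring

theorem pp_div_den_mem_form {ε : ℂ} (hε : ε ≠ 0) {f : ℂ → ℂ} {a : ℂ} (ha : a ^ 2 = 1)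
    (hf : MeromorphicAt f a) (hinv : ∀ᶠ q in 𝓝[≠] a, f q⁻¹ = q ^ 4 * f q) :
    pp a (fun q => f q / den ε q) ∈ Form 2 := by
  refine pp_mem_form ha (hf.div (den_meromorphicAt hε ha)) ?_
  filter_upwards [hinv, eventually_ne_punctured a 0] with q h1 h2
  rw [h1, den_inv ε h2]
  field_simp

/-- Coefficient of the odd part of the bidifferential `B`. It agrees with `Bodd` for `q ≠ 0` and,
unlike `Bodd`, is analytic at `q = 0`. -/
def oddB (q w : ℂ) : ℂ := 1 / 2 * (1 / (q - w) ^ 2 + 1 / (1 - q * w) ^ 2)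

theorem Bodd_eq_oddB {q : ℂ} (hq : q ≠ 0) (w : ℂ) : Bodd q w = oddB q w := by
  have h : B (inv q) w * dinv q = -(1 / (1 - q * w) ^ 2) := by
    rw [B, inv, dinv]
    have : (1 / q - w) = (1 - q * w) / q := by field_simp
    rw [this, div_pow]
    field_simp
  rw [Bodd, oddB, h, B]
  ring

theorem oddB_comm (q w : ℂ) : oddB q w = oddB w q := by
  rw [oddB, oddB, mul_comm w q, ← neg_sub w q, neg_sq]

theorem oddB_inv {q : ℂ} (hq : q ≠ 0) (w : ℂ) : oddB q⁻¹ w = q ^ 2 * oddB q w := by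
  rw [oddB, oddB]
  have h1 : q⁻¹ - w = (1 - q * w) / q := by field_simp
  have h2 : 1 - q⁻¹ * w = (q - w) / q := by field_simp
  rw [h1, h2, div_pow, div_pow]
  field_simp
  ring

theorem oddB_analyticAt {q w : ℂ} (h1 : q ≠ w) (h2 : q * w ≠ 1) :
    AnalyticAt ℂ (fun q => oddB q w) q := by
  have h3 : q - w ≠ 0 := sub_ne_zero.2 h1
  have h4 : 1 - q * w ≠ 0 := sub_ne_zero.2 h2.symm
  unfold oddB
  fun_prop (disch := positivity)

theorem oddB_analyticAt_of_sq {a w : ℂ} (ha : a ^ 2 = 1) (hw : w ^ 2 ≠ 1) :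
    AnalyticAt ℂ (fun q => oddB q w) a := by
  refine oddB_analyticAt (by rintro rfl; exact hw ha) fun h => hw ?_
  have : w ^ 2 = (a * w) ^ 2 := by rw [mul_pow, ha, one_mul]
  rw [this, h, one_pow]

/-- The odd forms `s^(2k) ds`, up to a constant, in the coordinate `s = (z - a)/(z + a)`, in which
the involution is `s ↦ -s`. -/
def basisForm (a : ℂ) (k : ℕ) (q : ℂ) : ℂ := (q - a) ^ (2 * k) / (q + a) ^ (2 * k + 2)

theorem basisForm_mem {a : ℂ} (ha : a ^ 2 = 1) (k : ℕ) : basisForm a k ∈ Form 2 := by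
  refine ⟨fun z hz => ?_, fun b _ => ?_, fun z hz => ?_⟩
  · have : z + a ≠ 0 := fun h => hz (by rw [eq_neg_of_add_eq_zero_left h, neg_sq, ha])
    unfold basisForm
    fun_prop (disch := positivity)
  · unfold basisForm
    fun_prop
  · have h0 := ne_zero_of_sq ha
    have h1 : z⁻¹ - a = -a * (z - a) / z := by
      field_simp
      linear_combination -ha
    have h2 : z⁻¹ + a = a * (z + a) / z := by
      field_simp
      linear_combination -ha
    have h3 : (a : ℂ) ^ (2 * k) = 1 := by rw [pow_mul, ha, one_pow]
    have h4 : (a : ℂ) ^ (2 * k + 2) = 1 := by rw [pow_add, h3, ha, one_mul]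
    have h5 : (-a : ℂ) ^ (2 * k) = 1 := by rw [pow_mul, neg_sq, ha, one_pow]
    rw [basisForm, basisForm, h1, h2, div_pow, div_pow, mul_pow, mul_pow, h5, h4, pow_add z]
    have hz1 : z ^ (2 * k) ≠ 0 := pow_ne_zero _ hz
    field_simp

/-- The Taylor expansion of the odd part of `B` at a ramification point, in even powers of
`s = (q - a)/(q + a)`. -/
theorem oddB_expansion {a w : ℂ} (ha : a ^ 2 = 1) (hw : w ^ 2 ≠ 1) (n : ℕ) :
    ∃ r, AnalyticAt ℂ r a ∧ ∀ᶠ q in 𝓝[≠] a, oddB q w =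
      ∑ k ∈ Finset.range n, 4 * (2 * (k : ℂ) + 1) * basisForm a k q * basisForm (-a) k w +
        (q - a) ^ (2 * n) * r q := by
  have h0 := ne_zero_of_sq ha
  have hwa : w - a ≠ 0 := sub_ne_zero.2 (by rintro rfl; exact hw ha)
  have hwa' : w + a ≠ 0 := fun h => hw (by rw [eq_neg_of_add_eq_zero_left h, neg_sq, ha])
  have h2a : a + a ≠ 0 := by
    rw [← two_mul]
    exact mul_ne_zero two_ne_zero h0
  have hwa2 : w * a - 1 ≠ 0 := by
    have : w * a - 1 = a * (w - a) := by linear_combination ha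
    rw [this]
    exact mul_ne_zero h0 hwa
  -- with `s = (q - a)/(q + a)` and `t = (w - a)/(w + a)`, the odd part of `B` is
  -- `(s² + t²)/(s² - t²)² ds dt = ∑ (2k + 1) s^(2k) t^(-2k-2) ds dt`; `r n` is the tail of this
  -- series in closed form, divided by `(q - a)^(2n)`
  let r : ℕ → ℂ → ℂ := fun n q => (w + a) ^ (2 * n) *
    ((2 * n + 1) * ((w - a) * (q + a)) ^ 2 - (2 * n - 1) * ((q - a) * (w + a)) ^ 2) /
    (4 * (q + a) ^ (2 * n) * (w - a) ^ (2 * n) * ((w - q) * (w * q - 1)) ^ 2)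
  have hr : ∀ n, AnalyticAt ℂ (r n) a := by
    intro n
    have : 4 * (a + a) ^ (2 * n) * (w - a) ^ (2 * n) * ((w - a) * (w * a - 1)) ^ 2 ≠ 0 := by
      exact mul_ne_zero (mul_ne_zero (mul_ne_zero (by norm_num) (pow_ne_zero _ h2a))
        (pow_ne_zero _ hwa)) (pow_ne_zero _ (mul_ne_zero hwa hwa2))
    fun_prop (disch := assumption)
  refine ⟨r n, hr n, ?_⟩
  filter_upwards [eventually_ne_punctured a (-a), eventually_ne_punctured a w,
    eventually_ne_punctured a w⁻¹, eventually_ne_punctured a a] with q h1 h2 h3 h4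
  have e1 : q + a ≠ 0 := fun h => h1 (eq_neg_of_add_eq_zero_left h)
  have e2 : w - q ≠ 0 := sub_ne_zero.2 h2.symm
  have e3 : w * q - 1 ≠ 0 := fun h => h3 (eq_inv_of_mul_eq_one_right (sub_eq_zero.1 h))
  have key : (((w - a) * (q + a)) ^ 2 - ((q - a) * (w + a)) ^ 2) ^ 2 =
      16 * ((w - q) * (w * q - 1)) ^ 2 := by
    have : ((w - a) * (q + a)) ^ 2 - ((q - a) * (w + a)) ^ 2 =
        4 * a * ((w - q) * (w * q - 1)) := by
      linear_combination (-4 * a * (w - q)) * ha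
    rw [this, mul_pow, mul_pow, ha]
    ring
  have hstep : ∀ n : ℕ, r n q = 4 * (2 * (n : ℂ) + 1) * (1 / (q + a) ^ (2 * n + 2)) *
      basisForm (-a) n w + (q - a) ^ 2 * r (n + 1) q := by
    intro n
    have e4 : ∀ u : ℂ, u ^ (2 * (n + 1)) = u ^ (2 * n) * u ^ 2 := fun u => by ring
    have e5 : ∀ u : ℂ, u ^ (2 * n + 2) = u ^ (2 * n) * u ^ 2 := fun u => by ring
    have e6 : (w - q) * (w * q - 1) ≠ 0 := mul_ne_zero e2 e3
    simp only [r, basisForm, sub_neg_eq_add, ← sub_eq_add_neg, e4, e5]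
    push_cast
    generalize (w - q) * (w * q - 1) = Z at *
    have e7 : (q + a) ^ (2 * n) ≠ 0 := pow_ne_zero _ e1
    have e8 : (w - a) ^ (2 * n) ≠ 0 := pow_ne_zero _ hwa
    generalize (q + a) ^ (2 * n) = X1 at *
    generalize (w - a) ^ (2 * n) = X2 at *
    generalize (w + a) ^ (2 * n) = X3 at *
    generalize q + a = P at *
    generalize w - a = V at *
    generalize w + a = U at *
    generalize q - a = M at *
    field_simp
    linear_combination X3 * (2 * (n : ℂ) + 1) * key
  induction n with
  | zero =>
    have e7 : q - w ≠ 0 := sub_ne_zero.2 h2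
    have e8 : 1 - q * w ≠ 0 := fun h => e3 (by linear_combination -h)
    have e9 : w - q = -(q - w) := by ring
    have e10 : w * q - 1 = -(1 - q * w) := by ring
    have e11 : ((w - a) * (q + a)) ^ 2 + ((q - a) * (w + a)) ^ 2 =
        2 * ((q - w) ^ 2 + (1 - q * w) ^ 2) := by
      linear_combination (2 * a ^ 2 + 2 - 4 * w * q + 2 * (q - w) ^ 2) * ha
    simp only [r, oddB, e9, e10, Finset.range_zero, Finset.sum_empty, mul_zero, pow_zero,
      Nat.cast_zero]
    have e12 : ((0 + 1) * ((w - a) * (q + a)) ^ 2 - (0 - 1) * ((q - a) * (w + a)) ^ 2) =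
        2 * ((q - w) ^ 2 + (1 - q * w) ^ 2) := by linear_combination e11
    rw [e12]
    field_simp
    ring
  | succ n ih =>
    have e4 : basisForm a n q = (q - a) ^ (2 * n) * (1 / (q + a) ^ (2 * n + 2)) := by
      rw [basisForm, mul_one_div]
    rw [ih, Finset.sum_range_succ, hstep n, e4]
    generalize 1 / (q + a) ^ (2 * n + 2) = u
    ring

/-! ### Sums of products of forms -/

/-- The span of the functions `(q, z) ↦ f(q) ∏ gᵢ(zᵢ)`, the product over `i ∈ S`, where `f` is a
form of weight `k` and every `gᵢ` one of weight `2`. -/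
def Mix {m : ℕ} (k : ℕ) (S : Finset (Fin m)) : Submodule ℂ (ℂ → (Fin m → ℂ) → ℂ) :=
  Submodule.span ℂ {G | ∃ f ∈ Form k, ∃ g : Fin m → ℂ → ℂ, (∀ i, g i ∈ Form 2) ∧
    G = fun q z => f q * ∏ i ∈ S, g i (z i)}

theorem Mix.of {m k : ℕ} {S : Finset (Fin m)} {f : ℂ → ℂ} (hf : f ∈ Form k)
    {g : Fin m → ℂ → ℂ} (hg : ∀ i, g i ∈ Form 2) :
    (fun q z => f q * ∏ i ∈ S, g i (z i)) ∈ Mix k S :=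
  Submodule.subset_span ⟨f, hf, g, hg, rfl⟩

theorem Mix.form {m k : ℕ} {S : Finset (Fin m)} {G : ℂ → (Fin m → ℂ) → ℂ} (hG : G ∈ Mix k S)
    (z : Fin m → ℂ) : (fun q => G q z) ∈ Form k := by
  induction hG using Submodule.span_induction with
  | mem G h =>
    obtain ⟨f, hf, g, hg, rfl⟩ := h
    have := (Form k).smul_mem (∏ i ∈ S, g i (z i)) hf
    convert this using 1
    funext q
    simp [mul_comm]
  | zero => exact (Form k).zero_mem
  | add G G' _ _ h h' => exact (Form k).add_mem h h'
  | smul c G _ h => exact (Form k).smul_mem c h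

/-- A linear map sends a `Mix` space into a submodule as soon as it does so on products. -/
theorem Mix.map {m k : ℕ} {S : Finset (Fin m)} {M : Type*} [AddCommMonoid M] [Module ℂ M]
    (φ : (ℂ → (Fin m → ℂ) → ℂ) →ₗ[ℂ] M) (W : Submodule ℂ M)
    (h : ∀ f ∈ Form k, ∀ g : Fin m → ℂ → ℂ, (∀ i, g i ∈ Form 2) →
      φ (fun q z => f q * ∏ i ∈ S, g i (z i)) ∈ W)
    {G : ℂ → (Fin m → ℂ) → ℂ} (hG : G ∈ Mix k S) : φ G ∈ W := by
  have : Mix k S ≤ W.comap φ := by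
    refine Submodule.span_le.2 ?_
    rintro _ ⟨f, hf, g, hg, rfl⟩
    exact h f hf g hg
  exact this hG

/-- Complementary sets of variables multiply to a function of all of them, and odd forms in `q` to a
quadratic differential. -/
theorem Mix.mul {m : ℕ} {J : Finset (Fin m)} {G G' : ℂ → (Fin m → ℂ) → ℂ} (hG : G ∈ Mix 2 J)
    (hG' : G' ∈ Mix 2 Jᶜ) : (fun q z => G q z * G' q z) ∈ Mix 4 (Finset.univ : Finset (Fin m)) := by
  refine Mix.map (LinearMap.mulRight ℂ G') _ (fun f hf g hg => ?_) hG
  refine Mix.map (LinearMap.mulLeft ℂ (fun q z => f q * ∏ i ∈ J, g i (z i))) _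
    (fun f' hf' g' hg' => ?_) hG'
  have h1 := Mix.of (S := Finset.univ) (Form.mul hf hf')
    (g := fun i => if i ∈ J then g i else g' i) (fun i => by
      by_cases hi : i ∈ J
      · simpa [hi] using hg i
      · simpa [hi] using hg' i)
  convert h1 using 1
  funext q z
  have h2 : ∏ i, (if i ∈ J then g i else g' i) (z i) =
      (∏ i ∈ J, g i (z i)) * ∏ i ∈ Jᶜ, g' i (z i) := by
    rw [← Finset.prod_mul_prod_compl J]
    congr 1
    · exact Finset.prod_congr rfl fun i hi => by rw [if_pos hi]
    · exact Finset.prod_congr rfl fun i hi => by rw [if_neg (Finset.mem_compl.1 hi)]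
  rw [h2]
  simp only [LinearMap.mulLeft_apply, Pi.mul_apply]
  ring

/-- Setting the first two variables equal. -/
theorem Mix.diag {m : ℕ} {G : ℂ → (Fin (m + 1) → ℂ) → ℂ} (hG : G ∈ Mix 2 Finset.univ) :
    (fun q z => G q (Fin.cons q z)) ∈ Mix 4 (Finset.univ : Finset (Fin m)) := by
  let φ : (ℂ → (Fin (m + 1) → ℂ) → ℂ) →ₗ[ℂ] (ℂ → (Fin m → ℂ) → ℂ) :=
    { toFun := fun G q z => G q (Fin.cons q z)
      map_add' := fun _ _ => rfl
      map_smul' := fun _ _ => rfl }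
  refine Mix.map φ _ (fun f hf g hg => ?_) hG
  convert Mix.of (S := Finset.univ) (Form.mul hf (hg 0)) (fun i => hg (Fin.succ i)) using 1
  funext q z
  simp only [φ, LinearMap.coe_mk, AddHom.coe_mk, Fin.prod_univ_succ, Fin.cons_zero, Fin.cons_succ]
  ring

/-- Oddness in the second variable, on the antidiagonal that occurs in the recursion. -/
theorem Mix.cons_inv {m : ℕ} {G : ℂ → (Fin (m + 1) → ℂ) → ℂ} (hG : G ∈ Mix 2 Finset.univ)
    {q : ℂ} (hq : q ≠ 0) (z : Fin m → ℂ) :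
    G q (Fin.cons q⁻¹ z) = q ^ 2 * G q (Fin.cons q z) := by
  let φ : (ℂ → (Fin (m + 1) → ℂ) → ℂ) →ₗ[ℂ] ℂ :=
    { toFun := fun G => G q (Fin.cons q⁻¹ z) - q ^ 2 * G q (Fin.cons q z)
      map_add' := fun F G => by
        simp only [Pi.add_apply]
        ring
      map_smul' := fun c G => by
        simp only [Pi.smul_apply, smul_eq_mul, RingHom.id_apply]
        ring }
  have : φ G ∈ (⊥ : Submodule ℂ ℂ) := by
    refine Mix.map φ _ (fun f hf g hg => ?_) hG
    rw [Submodule.mem_bot]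
    simp only [φ, LinearMap.coe_mk, AddHom.coe_mk, Fin.prod_univ_succ, Fin.cons_zero,
      Fin.cons_succ, Form.inv_eq (hg 0) hq]
    ring
  exact sub_eq_zero.1 this

/-- A function of the variables `z_J` is a function of `z` that only involves the variables with
index in `J`. -/
theorem Mix.sub {m k : ℕ} {J : Finset (Fin m)} {G : ℂ → (Fin J.card → ℂ) → ℂ}
    (hG : G ∈ Mix k Finset.univ) : (fun q z => G q (sub z J)) ∈ Mix k J := by
  let φ : (ℂ → (Fin J.card → ℂ) → ℂ) →ₗ[ℂ] (ℂ → (Fin m → ℂ) → ℂ) :=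
    { toFun := fun G q z => G q (P1Curve.sub z J)
      map_add' := fun _ _ => rfl
      map_smul' := fun _ _ => rfl }
  refine Mix.map φ _ (fun f hf g hg => ?_) hG
  let e := J.orderIsoOfFin rfl
  convert Mix.of (S := J) hf (g := fun i => if h : i ∈ J then g (e.symm ⟨i, h⟩) else 0)
    (fun i => by
      by_cases h : i ∈ J
      · simpa [h] using hg _
      · simp [h]) using 1
  funext q z
  simp only [φ, LinearMap.coe_mk, AddHom.coe_mk]
  congr 1
  rw [← Finset.prod_coe_sort J, ← e.toEquiv.prod_comp]
  refine Finset.prod_congr rfl fun i _ => ?_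
  have h1 : (e.toEquiv i : Fin m) ∈ J := (e.toEquiv i).2
  rw [dif_pos h1]
  exact congrArg (fun j => g j (z (J.orderEmbOfFin rfl i))) (e.symm_apply_apply i).symm

theorem Mix.div_den_meromorphicAt {ε : ℂ} (hε : ε ≠ 0) {m k : ℕ} {S : Finset (Fin m)}
    {G : ℂ → (Fin m → ℂ) → ℂ} (hG : G ∈ Mix k S) {a : ℂ} (ha : a ^ 2 = 1) (z : Fin m → ℂ) :
    MeromorphicAt (fun q => G q z / den ε q) a :=
  (Form.meromorphicAt (Mix.form hG z) ha).div (den_meromorphicAt hε ha)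

/-- Dividing by the kernel denominator and taking the principal part at a ramification point. -/
theorem Mix.pp_mem {ε : ℂ} (hε : ε ≠ 0) {m : ℕ} {S : Finset (Fin m)} {G : ℂ → (Fin m → ℂ) → ℂ}
    (hG : G ∈ Mix 4 S) {a : ℂ} (ha : a ^ 2 = 1) :
    (fun p z => pp a (fun q => G q z / den ε q) p) ∈ Mix 2 S := by
  induction hG using Submodule.span_induction with
  | mem G h =>
    obtain ⟨f, hf, g, hg, rfl⟩ := h
    have hm : MeromorphicAt (fun q => f q / den ε q) a :=
      (Form.meromorphicAt hf ha).div (den_meromorphicAt hε ha)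
    convert Mix.of (pp_div_den_mem_form hε ha (Form.meromorphicAt hf ha)
      ((eventually_ne_punctured a 0).mono fun q hq => Form.inv_eq hf hq)) hg using 1
    funext p z
    rw [mul_comm, ← pp_const_mul hm]
    congr 1
    funext q
    ring
  | zero =>
    simp only [Pi.zero_apply, zero_div, pp_zero]
    exact Submodule.zero_mem _
  | add G G' hG hG' h h' =>
    convert Submodule.add_mem _ h h' using 1
    funext p z
    simp only [Pi.add_apply, add_div]
    exact pp_add (Mix.div_den_meromorphicAt hε hG ha z) (Mix.div_den_meromorphicAt hε hG' ha z) p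
  | smul c G hG h =>
    convert Submodule.smul_mem _ c h using 1
    funext p z
    simp only [Pi.smul_apply, smul_eq_mul, mul_div_assoc]
    exact pp_const_mul (Mix.div_den_meromorphicAt hε hG ha z) c p

/-- The principal part of `f(q) / den(q)` times the odd part of `B(q, w)` is a finite sum of
products of forms in `p` and in `w`: only finitely many Taylor coefficients of `B` contribute. -/
theorem pp_oddB_mul {ε : ℂ} (hε : ε ≠ 0) {a : ℂ} (ha : a ^ 2 = 1) {f : ℂ → ℂ}
    (hf : MeromorphicAt f a) : ∃ n : ℕ, ∀ w p, w ^ 2 ≠ 1 → p ^ 2 ≠ 1 →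
      pp a (fun q => oddB q w * f q / den ε q) p =
        ∑ k ∈ Finset.range n, 4 * (2 * (k : ℂ) + 1) * basisForm (-a) k w *
          pp a (fun q => basisForm a k q * f q / den ε q) p := by
  have hfd : MeromorphicAt (fun q => f q / den ε q) a := hf.div (den_meromorphicAt hε ha)
  obtain ⟨n, hn⟩ := hfd
  refine ⟨n, fun w p hw hp => ?_⟩
  obtain ⟨r, hr, h⟩ := oddB_expansion ha hw n
  have hm : ∀ k, MeromorphicAt (fun q => basisForm a k q * f q / den ε q) a := fun k =>
    ((Form.meromorphicAt (basisForm_mem ha k) ha).mul hf).div (den_meromorphicAt hε ha)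
  have hpa : p ≠ a := by
    rintro rfl
    exact hp ha
  have hrem : AnalyticAt ℂ
      (fun q => (q - a) ^ n * r q * ((q - a) ^ n • (f q / den ε q))) a := by fun_prop
  have h1 : pp a (fun q => oddB q w * f q / den ε q) p =
      pp a (fun q => ∑ k ∈ Finset.range n, 4 * (2 * (k : ℂ) + 1) * basisForm (-a) k w *
        (basisForm a k q * f q / den ε q) +
          (q - a) ^ n * r q * ((q - a) ^ n • (f q / den ε q))) p := by
    refine pp_congr (h.mono fun q hq => ?_) p
    simp only [hq, smul_eq_mul]
    rw [add_mul, add_div, Finset.sum_mul, Finset.sum_div]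
    congr 1
    · exact Finset.sum_congr rfl fun k _ => by ring
    · ring
  rw [h1, pp_add (MeromorphicAt.fun_sum fun k _ => MeromorphicAt.const_mul (hm k) _)
    hrem.meromorphicAt,
    pp_of_analyticAt hrem hpa, add_zero, pp_sum fun k _ => MeromorphicAt.const_mul (hm k) _]
  exact Finset.sum_congr rfl fun k _ => pp_const_mul (hm k) _ p

theorem Mix.oddB_meromorphicAt {ε : ℂ} (hε : ε ≠ 0) {m k : ℕ} {S : Finset (Fin m)}
    {G : ℂ → (Fin m → ℂ) → ℂ} (hG : G ∈ Mix k S) {a : ℂ} (ha : a ^ 2 = 1) (z : Fin m → ℂ)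
    {w : ℂ} (hw : w ^ 2 ≠ 1) :
    MeromorphicAt (fun q => oddB q w * G q z / den ε q) a :=
  ((oddB_analyticAt_of_sq ha hw).meromorphicAt.mul (Form.meromorphicAt (Mix.form hG z) ha)).div
    (den_meromorphicAt hε ha)

/-- Multiplying by the odd part of `B(q, zᵢ)` and taking the principal part introduces a factor that
is a form in `zᵢ`. -/
theorem Mix.exists_pp_oddB {ε : ℂ} (hε : ε ≠ 0) {m : ℕ} {i : Fin m} {G : ℂ → (Fin m → ℂ) → ℂ}
    (hG : G ∈ Mix 2 (Finset.univ.erase i)) {a : ℂ} (ha : a ^ 2 = 1) :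
    ∃ F ∈ Mix 2 (Finset.univ : Finset (Fin m)), ∀ p z, p ^ 2 ≠ 1 → (∀ i, z i ^ 2 ≠ 1) →
      pp a (fun q => oddB q (z i) * G q z / den ε q) p = F p z := by
  induction hG using Submodule.span_induction with
  | mem G h =>
    obtain ⟨f, hf, g, hg, rfl⟩ := h
    obtain ⟨n, hn⟩ := pp_oddB_mul hε ha (Form.meromorphicAt hf ha)
    have hnega : (-a) ^ 2 = 1 := by rw [neg_sq, ha]
    have hmem : ∀ k ∈ Finset.range n, (fun (p : ℂ) (z : Fin m → ℂ) =>
        4 * (2 * (k : ℂ) + 1) * (pp a (fun q => basisForm a k q * f q / den ε q) p *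
          ∏ j, Function.update g i (basisForm (-a) k) j (z j))) ∈
          Mix 2 (Finset.univ : Finset (Fin m)) := by
      intro k _
      have hff := Form.mul (basisForm_mem ha k) hf
      refine Submodule.smul_mem _ (4 * (2 * (k : ℂ) + 1)) (Mix.of ?_ fun j => ?_)
      · exact pp_div_den_mem_form hε ha (Form.meromorphicAt hff ha)
          ((eventually_ne_punctured a 0).mono fun q hq => Form.inv_eq hff hq)
      · by_cases hj : j = i
        · subst hj
          simpa using basisForm_mem hnega k
        · simpa [hj] using hg j
    refine ⟨_, Submodule.sum_mem _ hmem, fun p z hp hz => ?_⟩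
    have hm : MeromorphicAt (fun q => oddB q (z i) * f q / den ε q) a :=
      ((oddB_analyticAt_of_sq ha (hz i)).meromorphicAt.mul (Form.meromorphicAt hf ha)).div
        (den_meromorphicAt hε ha)
    have h1 : pp a (fun q => oddB q (z i) *
        (f q * ∏ j ∈ Finset.univ.erase i, g j (z j)) / den ε q) p =
        (∏ j ∈ Finset.univ.erase i, g j (z j)) *
          pp a (fun q => oddB q (z i) * f q / den ε q) p := by
      rw [← pp_const_mul hm]
      congr 1
      funext q
      ring
    rw [h1, hn (z i) p (hz i) hp, Finset.mul_sum, Finset.sum_apply, Finset.sum_apply]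
    refine Finset.sum_congr rfl fun k _ => ?_
    have h2 : ∏ j, Function.update g i (basisForm (-a) k) j (z j) =
        basisForm (-a) k (z i) * ∏ j ∈ Finset.univ.erase i, g j (z j) := by
      rw [← Finset.mul_prod_erase Finset.univ _ (Finset.mem_univ i), Function.update_self]
      congr 1
      exact Finset.prod_congr rfl fun j hj => by
        rw [Function.update_of_ne (Finset.ne_of_mem_erase hj)]
    rw [h2]
    ring
  | zero =>
    refine ⟨0, Submodule.zero_mem _, fun p z _ _ => ?_⟩
    simp [pp_zero]
  | add G G' hG hG' h h' =>
    obtain ⟨F, hF, h⟩ := h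
    obtain ⟨F', hF', h'⟩ := h'
    refine ⟨F + F', Submodule.add_mem _ hF hF', fun p z hp hz => ?_⟩
    simp only [Pi.add_apply, mul_add, add_div]
    rw [pp_add (Mix.oddB_meromorphicAt hε hG ha z (hz i))
      (Mix.oddB_meromorphicAt hε hG' ha z (hz i)), h p z hp hz, h' p z hp hz]
  | smul c G hG h =>
    obtain ⟨F, hF, h⟩ := h
    refine ⟨c • F, Submodule.smul_mem _ c hF, fun p z hp hz => ?_⟩
    simp only [Pi.smul_apply, smul_eq_mul]
    rw [← h p z hp hz, ← pp_const_mul (Mix.oddB_meromorphicAt hε hG ha z (hz i))]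
    congr 1
    funext q
    ring


/-! ### The recursion in terms of principal parts -/

theorem inv_eq_inv (z : ℂ) : inv z = z⁻¹ := one_div z

theorem generic_of_sq {z : ℂ} (h0 : z ≠ 0) (h : z ^ 2 ≠ 1) : Generic z :=
  ⟨h0, by rintro rfl; exact h (one_pow 2), by rintro rfl; exact h (by norm_num)⟩

theorem inv_sq_ne_one {z : ℂ} (h : z ^ 2 ≠ 1) : z⁻¹ ^ 2 ≠ 1 := by
  rwa [inv_pow, Ne, inv_eq_one]

theorem eventually_generic (a : ℂ) : ∀ᶠ z in 𝓝[≠] a, Generic z :=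
  (eventually_sq_ne_one a).mono fun _ hz => generic_of_sq hz.1 hz.2

/-- The integral of `B(p, ·)` along a segment that avoids the pole. -/
theorem intB_eq {p q : ℂ} (h : p ∉ segment ℝ (inv q) q) :
    intB p q = 1 / (p - q) - 1 / (p - inv q) := by
  have hne : ∀ t ∈ Set.Icc (0 : ℝ) 1, p - (inv q + (t : ℂ) * (q - inv q)) ≠ 0 := by
    intro t ht h0
    refine h ?_
    rw [segment_eq_image']
    exact ⟨t, ht, by simp only [Complex.real_smul]; exact (sub_eq_zero.1 h0).symm⟩
  have hderiv : ∀ t ∈ Set.uIcc (0 : ℝ) 1,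
      HasDerivAt (fun t : ℝ => (p - (inv q + (t : ℂ) * (q - inv q)))⁻¹)
        (B p (inv q + (t : ℂ) * (q - inv q)) * (q - inv q)) t := by
    intro t ht
    rw [Set.uIcc_of_le zero_le_one] at ht
    have h1 : HasDerivAt (fun t : ℝ => p - (inv q + (t : ℂ) * (q - inv q)))
        (-(1 * (q - inv q))) t :=
      ((Complex.ofRealCLM.hasDerivAt.mul_const (q - inv q)).const_add (inv q)).const_sub p
    refine (h1.fun_inv (hne t ht)).congr_deriv ?_
    rw [B]
    ring
  have hint : IntervalIntegrable
      (fun t : ℝ => B p (inv q + (t : ℂ) * (q - inv q)) * (q - inv q))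
      MeasureTheory.volume 0 1 := by
    refine ContinuousOn.intervalIntegrable fun t ht => ContinuousAt.continuousWithinAt ?_
    rw [Set.uIcc_of_le zero_le_one] at ht
    have h2 := pow_ne_zero 2 (hne t ht)
    unfold B
    fun_prop (disch := assumption)
  rw [intB, intervalIntegral.integral_eq_sub_of_hasDerivAt hderiv hint]
  simp

theorem eventually_intB_eq {a p : ℂ} (ha : a ^ 2 = 1) (hp : p ≠ a) :
    ∀ᶠ q in 𝓝[≠] a, intB p q = 1 / (p - q) - 1 / (p - q⁻¹) := by
  have h0 := ne_zero_of_sq ha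
  have hr : 0 < dist p a := dist_pos.2 hp
  have h1 : ∀ᶠ q in 𝓝 a, q ∈ Metric.ball a (dist p a) := Metric.ball_mem_nhds a hr
  have h2 : ∀ᶠ q in 𝓝 a, q⁻¹ ∈ Metric.ball a (dist p a) := by
    have h3 : Tendsto (fun q : ℂ => q⁻¹) (𝓝 a) (𝓝 a) := by
      have := tendsto_inv₀ h0
      rwa [inv_eq_self_of_sq ha] at this
    exact h3.eventually (Metric.ball_mem_nhds a hr)
  filter_upwards [h1.filter_mono nhdsWithin_le_nhds, h2.filter_mono nhdsWithin_le_nhds]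
    with q hq1 hq2
  rw [← inv_eq_inv] at hq2 ⊢
  refine intB_eq fun h => ?_
  have := (convex_ball a (dist p a)).segment_subset hq2 hq1 h
  exact lt_irrefl _ (Metric.mem_ball.1 this)

/-- Against an even quadratic differential, the recursion kernel extracts principal parts. -/
theorem residue_kernel {ε : ℂ} (hε : ε ≠ 0) {a p : ℂ} (ha : a ^ 2 = 1) (hp : p ≠ a) {H X : ℂ → ℂ}
    (hH : MeromorphicAt H a) (hinv : ∀ᶠ q in 𝓝[≠] a, H q⁻¹ = q ^ 4 * H q)
    (hX : ∀ᶠ q in 𝓝[≠] a, dinv q * X q = -H q) :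
    residue (fun q => kernel ε p q * dinv q * X q) a = -pp a (fun q => H q / den ε q) p := by
  have h0 := ne_zero_of_sq ha
  have hai := inv_eq_self_of_sq ha
  have hm : MeromorphicAt (fun q => H q / den ε q) a := hH.div (den_meromorphicAt hε ha)
  have hm1 := hm.div_sub p
  have h1 := residue_inv h0 (f := fun q => H q / den ε q / (p - q)) (by rwa [hai])
  rw [hai] at h1
  have hm2 : MeromorphicAt (fun z : ℂ => H z⁻¹ / den ε z⁻¹ / (p - z⁻¹) * (-1 / z ^ 2)) a := by
    have h3 : MeromorphicAt (fun z : ℂ => H z / den ε z / (p - z)) a⁻¹ := by rwa [hai]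
    have h4 : MeromorphicAt (fun z : ℂ => H z⁻¹ / den ε z⁻¹ / (p - z⁻¹)) a :=
      h3.comp_analyticAt (analyticAt_inv h0)
    fun_prop
  have h2 : residue (fun q => kernel ε p q * dinv q * X q) a =
      residue (fun q => (-1 / 2) * (H q / den ε q / (p - q)) +
        (-1 / 2) * (H q⁻¹ / den ε q⁻¹ / (p - q⁻¹) * (-1 / q ^ 2))) a := by
    refine residue_congr ?_
    filter_upwards [eventually_intB_eq ha hp, hinv, hX, eventually_ne_punctured a 0]
      with q h3 h4 h5 h6
    have h7 : kernel ε p q * dinv q * X q = kernel ε p q * (dinv q * X q) := by ring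
    rw [h7, h5, h4, den_inv ε h6, kernel, h3]
    change 1 / 2 * _ / den ε q * _ = _
    field_simp
    ring
  rw [h2, residue_add (hm1.const_mul _) (hm2.const_mul _), residue_const_mul hm1,
    residue_const_mul hm2, h1, pp]
  ring

/-- The bracket in the recursion for `ω_{g,1+m}`: the terms that the kernel is applied to. -/
def bracket (ε : ℂ) (g m : ℕ) (z : Fin m → ℂ) (q : ℂ) : ℂ :=
  (if g = 0 then 0 else corr ε (g - 1) (m + 1) q (Fin.cons (inv q) z)) +
    ∑ h ∈ Finset.range (g + 1), ∑ J : Finset (Fin m),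
      if (h = 0 ∧ J.card = 0) ∨ (g - h = 0 ∧ Jᶜ.card = 0) then 0
      else corr ε h J.card q (sub z J) * corr ε (g - h) Jᶜ.card (inv q) (sub z Jᶜ)

theorem corr_eq_residue (ε : ℂ) {g m : ℕ} (h : 2 ≤ 2 * g + m) (p : ℂ) (z : Fin m → ℂ) :
    corr ε g m p z = residue (fun q => kernel ε p q * dinv q * bracket ε g m z q) 1 +
      residue (fun q => kernel ε p q * dinv q * bracket ε g m z q) (-1) := by
  rw [corr, if_neg (by omega), dif_neg (by omega)]
  simp only [bracket, Finset.sum_range, dite_eq_ite]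

theorem corr_zero_one (ε : ℂ) {m : ℕ} (hm : m = 1) (p : ℂ) (z : Fin m → ℂ) :
    corr ε 0 m p z = B p (z ⟨0, by omega⟩) := by
  rw [corr, if_neg (by omega), dif_pos ⟨rfl, hm⟩]

theorem corr_singleton (ε : ℂ) {m : ℕ} (p : ℂ) (z : Fin m → ℂ) (i : Fin m) :
    corr ε 0 ({i} : Finset (Fin m)).card p (sub z {i}) = B p (z i) := by
  rw [corr_zero_one ε (Finset.card_singleton i), sub]
  congr 2
  exact Finset.mem_singleton.1 (Finset.orderEmbOfFin_mem _ _ _)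

/-- If the bracket of the recursion is the even quadratic differential `-H`, then the correlator is
minus the sum of the principal parts of `H / den` at the ramification points. -/
theorem corr_eq_pp {ε : ℂ} (hε : ε ≠ 0) {g m : ℕ} (h : 2 ≤ 2 * g + m) {p : ℂ} (hp : p ^ 2 ≠ 1)
    {z : Fin m → ℂ} {H : ℂ → ℂ} (hH : ∀ a, a ^ 2 = 1 → MeromorphicAt H a)
    (hinv : ∀ a : ℂ, a ^ 2 = 1 → ∀ᶠ q in 𝓝[≠] a, H q⁻¹ = q ^ 4 * H q)
    (hX : ∀ a : ℂ, a ^ 2 = 1 → ∀ᶠ q in 𝓝[≠] a, dinv q * bracket ε g m z q = -H q) :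
    corr ε g m p z =
      -(pp 1 (fun q => H q / den ε q) p + pp (-1) (fun q => H q / den ε q) p) := by
  have h1 : (1 : ℂ) ^ 2 = 1 := one_pow 2
  have h2 : (-1 : ℂ) ^ 2 = 1 := by norm_num
  rw [corr_eq_residue ε h,
    residue_kernel hε h1 (by rintro rfl; exact hp h1) (hH 1 h1) (hinv 1 h1) (hX 1 h1),
    residue_kernel hε h2 (by rintro rfl; exact hp h2) (hH _ h2) (hinv _ h2) (hX _ h2)]
  ring

/-! ### The structure of the stable correlators -/

/-- Away from `±1`, `ω_{g,1+m}` is a finite sum of products of odd forms with poles only at the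
ramification points. -/
def IsStableForm (ε : ℂ) (g m : ℕ) : Prop :=
  ∃ F ∈ Mix 2 (Finset.univ : Finset (Fin m)), ∀ p z, p ^ 2 ≠ 1 → (∀ i, z i ^ 2 ≠ 1) →
    corr ε g m p z = F p z

theorem IsStableForm.inv_apply {ε : ℂ} {g m : ℕ} (h : IsStableForm ε g m) {q : ℂ} (hq : Generic q)
    {z : Fin m → ℂ} (hz : ∀ i, z i ^ 2 ≠ 1) :
    corr ε g m (inv q) z = q ^ 2 * corr ε g m q z := by
  obtain ⟨F, hF, h⟩ := h
  rw [inv_eq_inv, h _ z (inv_sq_ne_one (sq_ne_one hq)) hz, h _ z (sq_ne_one hq) hz,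
    Form.inv_eq (Mix.form hF z) hq.1]

theorem IsStableForm.cons_inv {ε : ℂ} {g m : ℕ} (h : IsStableForm ε g (m + 1)) {q : ℂ}
    (hq : Generic q) {z : Fin m → ℂ} (hz : ∀ i, z i ^ 2 ≠ 1) :
    corr ε g (m + 1) q (Fin.cons (inv q) z) = q ^ 2 * corr ε g (m + 1) q (Fin.cons q z) := by
  obtain ⟨F, hF, h⟩ := h
  rw [inv_eq_inv, h q _ (sq_ne_one hq) (Fin.cases (inv_sq_ne_one (sq_ne_one hq)) hz),
    h q _ (sq_ne_one hq) (Fin.cases (sq_ne_one hq) hz), Mix.cons_inv hF hq.1]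

theorem sub_sq_ne_one {m : ℕ} {z : Fin m → ℂ} (hz : ∀ i, z i ^ 2 ≠ 1) (J : Finset (Fin m)) :
    ∀ i, sub z J i ^ 2 ≠ 1 := fun _ => hz _

theorem dinv_mul_sq_mul {q : ℂ} (hq : q ≠ 0) (c : ℂ) : dinv q * (q ^ 2 * c) = -c := by
  rw [dinv]
  field_simp

theorem dinv_mul_B_inv {q : ℂ} (hq : q ≠ 0) (w : ℂ) :
    dinv q * B (inv q) w = -(1 / (1 - q * w) ^ 2) := by
  rw [B, inv, dinv]
  have : (1 / q - w) = (1 - q * w) / q := by field_simp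
  rw [this, div_pow]
  field_simp

/-- The even quadratic differential whose quotient by `(y(q) - y(1/q)) dx(q)` has the principal
parts of `-ω_{g,1+m}(q, z)`, for `2g + m ≥ 3`. -/
def num (ε : ℂ) (g m : ℕ) (z : Fin m → ℂ) (q : ℂ) : ℂ :=
  (∑ i, 2 * oddB q (z i) *
      corr ε g (Finset.univ.erase i).card q (sub z (Finset.univ.erase i))) +
    (if g = 0 then 0 else corr ε (g - 1) (m + 1) q (Fin.cons q z)) +
    ∑ h ∈ Finset.range (g + 1), ∑ J : Finset (Fin m),
      if 0 < 2 * (h : ℤ) - 2 + (1 + (J.card : ℤ)) ∧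
          0 < 2 * ((g - h : ℕ) : ℤ) - 2 + (1 + (Jᶜ.card : ℤ)) then
        corr ε h J.card q (sub z J) * corr ε (g - h) Jᶜ.card q (sub z Jᶜ)
      else 0

theorem sum_card_one {m : ℕ} (f : Finset (Fin m) → ℂ) :
    ∑ J : Finset (Fin m), (if J.card = 1 then f J else 0) = ∑ i, f {i} := by
  rw [← Finset.sum_filter, Finset.univ_filter_card_eq, Finset.powersetCard_one, Finset.sum_map]
  rfl

theorem sum_card_compl_one {m : ℕ} (f : Finset (Fin m) → ℂ) :
    ∑ J : Finset (Fin m), (if Jᶜ.card = 1 then f J else 0) =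
      ∑ i, f (Finset.univ.erase i) := by
  rw [← Fintype.sum_bijective compl compl_involutive.bijective
    (fun J : Finset (Fin m) => if J.card = 1 then f Jᶜ else 0) _ (fun J => by rw [compl_compl]),
    sum_card_one]
  refine Finset.sum_congr rfl fun i _ => ?_
  rw [Finset.compl_singleton]

/-- The bracket of the recursion is `-num`, because replacing `1/q` by `q` in an odd form costs a
sign. -/
theorem dinv_mul_bracket {ε : ℂ} {g m : ℕ} (h : 3 ≤ 2 * g + m)
    (ih : ∀ g' m', 2 ≤ 2 * g' + m' → 2 * g' + m' < 2 * g + m → IsStableForm ε g' m')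
    {z : Fin m → ℂ} (hz : ∀ i, z i ^ 2 ≠ 1) {q : ℂ} (hq : Generic q) :
    dinv q * bracket ε g m z q = -num ε g m z q := by
  have e1 : dinv q * (if g = 0 then 0 else corr ε (g - 1) (m + 1) q (Fin.cons (inv q) z)) =
      -(if g = 0 then 0 else corr ε (g - 1) (m + 1) q (Fin.cons q z)) := by
    by_cases hg : g = 0
    · simp [hg]
    · rw [if_neg hg, if_neg hg, (ih (g - 1) (m + 1) (by omega) (by omega)).cons_inv hq hz,
        dinv_mul_sq_mul hq.1]
  -- the terms with a factor `ω_{0,2}(q, ·)`, those with a factor `ω_{0,2}(1/q, ·)`, and the rest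
  have e2 : ∀ t ∈ Finset.range (g + 1), ∀ J : Finset (Fin m),
      dinv q * (if (t = 0 ∧ J.card = 0) ∨ (g - t = 0 ∧ Jᶜ.card = 0) then 0
        else corr ε t J.card q (sub z J) * corr ε (g - t) Jᶜ.card (inv q) (sub z Jᶜ)) =
      -((if t = 0 then (if J.card = 1 then
          corr ε 0 J.card q (sub z J) * corr ε g Jᶜ.card q (sub z Jᶜ) else 0) else 0) +
        (if t = g then (if Jᶜ.card = 1 then
          corr ε g J.card q (sub z J) * -(dinv q * corr ε 0 Jᶜ.card (inv q) (sub z Jᶜ))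
            else 0) else 0) +
        (if 0 < 2 * (t : ℤ) - 2 + (1 + (J.card : ℤ)) ∧
            0 < 2 * ((g - t : ℕ) : ℤ) - 2 + (1 + (Jᶜ.card : ℤ)) then
          corr ε t J.card q (sub z J) * corr ε (g - t) Jᶜ.card q (sub z Jᶜ) else 0)) := by
    intro t ht J
    have hJ : J.card + Jᶜ.card = m := by
      rw [Finset.card_add_card_compl, Fintype.card_fin]
    rw [Finset.mem_range] at ht
    by_cases hexc : (t = 0 ∧ J.card = 0) ∨ (g - t = 0 ∧ Jᶜ.card = 0)
    · rw [if_pos hexc]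
      have h1 : (if t = 0 then (if J.card = 1 then
          corr ε 0 J.card q (sub z J) * corr ε g Jᶜ.card q (sub z Jᶜ) else 0) else 0) = 0 := by
        split_ifs <;> first | rfl | omega
      have h2 : (if t = g then (if Jᶜ.card = 1 then
          corr ε g J.card q (sub z J) * -(dinv q * corr ε 0 Jᶜ.card (inv q) (sub z Jᶜ))
            else 0) else 0) = 0 := by
        split_ifs <;> first | rfl | omega
      rw [h1, h2, if_neg (by omega)]
      simp
    rw [if_neg hexc]
    by_cases hA : t = 0 ∧ J.card = 1
    · obtain ⟨rfl, hA⟩ := hA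
      rw [if_pos rfl, if_pos hA, if_neg (c := 0 < 2 * ((0 : ℕ) : ℤ) - 2 + (1 + (J.card : ℤ)) ∧ _)
        (by omega)]
      have h2 : (if 0 = g then (if Jᶜ.card = 1 then
          corr ε g J.card q (sub z J) * -(dinv q * corr ε 0 Jᶜ.card (inv q) (sub z Jᶜ))
            else 0) else 0) = 0 := by
        split_ifs <;> first | rfl | omega
      rw [h2, Nat.sub_zero, (ih g Jᶜ.card (by omega) (by omega)).inv_apply hq (sub_sq_ne_one hz _)]
      rw [mul_left_comm, dinv_mul_sq_mul hq.1]
      ring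
    have h1 : (if t = 0 then (if J.card = 1 then
        corr ε 0 J.card q (sub z J) * corr ε g Jᶜ.card q (sub z Jᶜ) else 0) else 0) = 0 := by
      split_ifs <;> first | rfl | omega
    rw [h1]
    by_cases hA' : t = g ∧ Jᶜ.card = 1
    · obtain ⟨rfl, hA'⟩ := hA'
      rw [if_pos rfl, if_pos hA', if_neg (by omega), Nat.sub_self]
      ring
    have h2 : (if t = g then (if Jᶜ.card = 1 then
        corr ε g J.card q (sub z J) * -(dinv q * corr ε 0 Jᶜ.card (inv q) (sub z Jᶜ))
          else 0) else 0) = 0 := by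
      split_ifs <;> first | rfl | omega
    rw [h2, if_pos (by omega),
      (ih (g - t) Jᶜ.card (by omega) (by omega)).inv_apply hq (sub_sq_ne_one hz _),
      mul_left_comm, dinv_mul_sq_mul hq.1]
    ring
  have e3 : ∀ i, corr ε 0 ({i} : Finset (Fin m)).card q (sub z {i}) *
        corr ε g ({i} : Finset (Fin m))ᶜ.card q (sub z {i}ᶜ) +
      corr ε g (Finset.univ.erase i).card q (sub z (Finset.univ.erase i)) *
        -(dinv q * corr ε 0 (Finset.univ.erase i)ᶜ.card (inv q) (sub z (Finset.univ.erase i)ᶜ)) =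
      2 * oddB q (z i) *
        corr ε g (Finset.univ.erase i).card q (sub z (Finset.univ.erase i)) := by
    intro i
    have h1 : ({i} : Finset (Fin m))ᶜ = Finset.univ.erase i := by
      ext j
      simp
    have h2 : (Finset.univ.erase i)ᶜ = ({i} : Finset (Fin m)) := by rw [← h1, compl_compl]
    rw [h1, h2, corr_singleton, corr_singleton, dinv_mul_B_inv hq.1, oddB, B]
    ring
  rw [bracket, mul_add, e1, Finset.mul_sum]
  have e4 : ∑ t ∈ Finset.range (g + 1), dinv q * (∑ J : Finset (Fin m),
      if (t = 0 ∧ J.card = 0) ∨ (g - t = 0 ∧ Jᶜ.card = 0) then 0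
        else corr ε t J.card q (sub z J) * corr ε (g - t) Jᶜ.card (inv q) (sub z Jᶜ)) =
      -((∑ i, 2 * oddB q (z i) *
          corr ε g (Finset.univ.erase i).card q (sub z (Finset.univ.erase i))) +
        ∑ h ∈ Finset.range (g + 1), ∑ J : Finset (Fin m),
          if 0 < 2 * (h : ℤ) - 2 + (1 + (J.card : ℤ)) ∧
              0 < 2 * ((g - h : ℕ) : ℤ) - 2 + (1 + (Jᶜ.card : ℤ)) then
            corr ε h J.card q (sub z J) * corr ε (g - h) Jᶜ.card q (sub z Jᶜ)
          else 0) := by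
    rw [Finset.sum_congr rfl fun t ht => (by
      rw [Finset.mul_sum, Finset.sum_congr rfl fun J _ => e2 t ht J, Finset.sum_neg_distrib,
        Finset.sum_add_distrib, Finset.sum_add_distrib] : _ = _)]
    rw [Finset.sum_neg_distrib, Finset.sum_add_distrib, Finset.sum_add_distrib]
    congr 2
    rw [Finset.sum_comm, Finset.sum_comm (s := Finset.range (g + 1))]
    simp only [Finset.sum_ite_eq', Finset.mem_range, Nat.succ_pos, if_true, Nat.lt_succ_self]
    rw [sum_card_one, sum_card_compl_one, ← Finset.sum_add_distrib]
    exact Finset.sum_congr rfl fun i _ => e3 i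
  rw [e4, num]
  ring

theorem exists_num_eq {ε : ℂ} {g m : ℕ} (h : 3 ≤ 2 * g + m)
    (ih : ∀ g' m', 2 ≤ 2 * g' + m' → 2 * g' + m' < 2 * g + m → IsStableForm ε g' m') :
    ∃ G ∈ Mix 4 (Finset.univ : Finset (Fin m)), ∃ F : Fin m → ℂ → (Fin m → ℂ) → ℂ,
      (∀ i, F i ∈ Mix 2 (Finset.univ.erase i)) ∧ ∀ z, (∀ i, z i ^ 2 ≠ 1) → ∀ q, q ^ 2 ≠ 1 →
        (∀ i, corr ε g (Finset.univ.erase i).card q (sub z (Finset.univ.erase i)) = F i q z) ∧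
        num ε g m z q = (∑ i, 2 * oddB q (z i) * F i q z) + G q z := by
  have hF : ∀ i : Fin m, ∃ F ∈ Mix 2 (Finset.univ.erase i), ∀ z, (∀ i, z i ^ 2 ≠ 1) → ∀ q,
      q ^ 2 ≠ 1 →
        corr ε g (Finset.univ.erase i).card q (sub z (Finset.univ.erase i)) = F q z := by
    intro i
    have hc : (Finset.univ.erase i).card = m - 1 := by simp
    have hm : 0 < m := i.pos
    obtain ⟨F, hF, h1⟩ := ih g (Finset.univ.erase i).card (by omega) (by omega)
    exact ⟨_, Mix.sub hF, fun z hz q hq => h1 q _ hq (sub_sq_ne_one hz _)⟩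
  choose F hFm hFe using hF
  have hD : ∃ D ∈ Mix 4 (Finset.univ : Finset (Fin m)), ∀ z, (∀ i, z i ^ 2 ≠ 1) → ∀ q,
      q ^ 2 ≠ 1 →
        (if g = 0 then 0 else corr ε (g - 1) (m + 1) q (Fin.cons q z)) = D q z := by
    by_cases hg : g = 0
    · exact ⟨0, Submodule.zero_mem _, fun z _ q _ => by simp [hg]⟩
    · obtain ⟨F, hF, h1⟩ := ih (g - 1) (m + 1) (by omega) (by omega)
      refine ⟨_, Mix.diag hF, fun z hz q hq => ?_⟩
      rw [if_neg hg]
      exact h1 q _ hq (Fin.cases hq hz)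
  have hP : ∀ t ∈ Finset.range (g + 1), ∀ J : Finset (Fin m),
      ∃ P ∈ Mix 4 (Finset.univ : Finset (Fin m)), ∀ z, (∀ i, z i ^ 2 ≠ 1) → ∀ q, q ^ 2 ≠ 1 →
        (if 0 < 2 * (t : ℤ) - 2 + (1 + (J.card : ℤ)) ∧
            0 < 2 * ((g - t : ℕ) : ℤ) - 2 + (1 + (Jᶜ.card : ℤ)) then
          corr ε t J.card q (sub z J) * corr ε (g - t) Jᶜ.card q (sub z Jᶜ) else 0) = P q z := by
    intro t ht J
    have hJ : J.card + Jᶜ.card = m := by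
      rw [Finset.card_add_card_compl, Fintype.card_fin]
    rw [Finset.mem_range] at ht
    split_ifs with hs
    · obtain ⟨F, hF, h1⟩ := ih t J.card (by omega) (by omega)
      obtain ⟨F', hF', h1'⟩ := ih (g - t) Jᶜ.card (by omega) (by omega)
      refine ⟨_, Mix.mul (Mix.sub hF) (Mix.sub hF'), fun z hz q hq => ?_⟩
      rw [h1 q _ hq (sub_sq_ne_one hz _), h1' q _ hq (sub_sq_ne_one hz _)]
    · exact ⟨0, Submodule.zero_mem _, fun z _ q _ => rfl⟩
  choose! P hPm hPe using hP
  obtain ⟨D, hDm, hDe⟩ := hD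
  refine ⟨D + ∑ t ∈ Finset.range (g + 1), ∑ J, P t J, Submodule.add_mem _ hDm
    (Submodule.sum_mem _ fun t ht => Submodule.sum_mem _ fun J _ => hPm t ht J), F, hFm,
    fun z hz q hq => ⟨fun i => hFe i z hz q hq, ?_⟩⟩
  rw [num, hDe z hz q hq, Pi.add_apply, Pi.add_apply, add_assoc]
  congr 1
  · exact Finset.sum_congr rfl fun i _ => by rw [hFe i z hz q hq]
  · congr 1
    simp only [Finset.sum_apply]
    exact Finset.sum_congr rfl fun t ht => Finset.sum_congr rfl fun J _ => hPe t ht J z hz q hq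

/-- A quadratic differential `∑ᵢ 2 B_odd(q, zᵢ) Fᵢ(q, z) + G(q, z)` is even. -/
theorem eval_inv {m : ℕ} {G : ℂ → (Fin m → ℂ) → ℂ} (hG : G ∈ Mix 4 Finset.univ)
    {F : Fin m → ℂ → (Fin m → ℂ) → ℂ} (hF : ∀ i, F i ∈ Mix 2 (Finset.univ.erase i))
    {q : ℂ} (hq : q ≠ 0) (z : Fin m → ℂ) :
    (∑ i, 2 * oddB q⁻¹ (z i) * F i q⁻¹ z) + G q⁻¹ z =
      q ^ 4 * ((∑ i, 2 * oddB q (z i) * F i q z) + G q z) := by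
  rw [mul_add, Finset.mul_sum, Form.inv_eq (Mix.form hG z) hq]
  congr 1
  refine Finset.sum_congr rfl fun i _ => ?_
  rw [Form.inv_eq (Mix.form (hF i) z) hq, oddB_inv hq]
  ring

theorem num_meromorphicAt {ε : ℂ} {g m : ℕ} (h : 3 ≤ 2 * g + m)
    (ih : ∀ g' m', 2 ≤ 2 * g' + m' → 2 * g' + m' < 2 * g + m → IsStableForm ε g' m')
    {z : Fin m → ℂ} (hz : ∀ i, z i ^ 2 ≠ 1) {a : ℂ} (ha : a ^ 2 = 1) :
    MeromorphicAt (num ε g m z) a := by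
  obtain ⟨G, hG, F, hF, hE⟩ := exists_num_eq h ih
  have h1 : MeromorphicAt (fun q => (∑ i, 2 * oddB q (z i) * F i q z) + G q z) a := by
    refine (MeromorphicAt.fun_sum fun i _ => ?_).fun_add (Form.meromorphicAt (Mix.form hG z) ha)
    exact ((MeromorphicAt.const 2 a).fun_mul
      (oddB_analyticAt_of_sq ha (hz i)).meromorphicAt).fun_mul
        (Form.meromorphicAt (Mix.form (hF i) z) ha)
  exact h1.congr ((eventually_sq_ne_one a).mono fun q hq => ((hE z hz q hq.2).2).symm)

theorem num_inv {ε : ℂ} {g m : ℕ} (h : 3 ≤ 2 * g + m)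
    (ih : ∀ g' m', 2 ≤ 2 * g' + m' → 2 * g' + m' < 2 * g + m → IsStableForm ε g' m')
    {z : Fin m → ℂ} (hz : ∀ i, z i ^ 2 ≠ 1) {q : ℂ} (hq : Generic q) :
    num ε g m z q⁻¹ = q ^ 4 * num ε g m z q := by
  obtain ⟨G, hG, F, hF, hE⟩ := exists_num_eq h ih
  rw [(hE z hz q (sq_ne_one hq)).2, (hE z hz _ (inv_sq_ne_one (sq_ne_one hq))).2,
    eval_inv hG hF hq.1]

theorem corr_eq_pp_num {ε : ℂ} (hε : ε ≠ 0) {g m : ℕ} (h : 3 ≤ 2 * g + m)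
    (ih : ∀ g' m', 2 ≤ 2 * g' + m' → 2 * g' + m' < 2 * g + m → IsStableForm ε g' m')
    {z : Fin m → ℂ} (hz : ∀ i, z i ^ 2 ≠ 1) {p : ℂ} (hp : p ^ 2 ≠ 1) :
    corr ε g m p z = -(pp 1 (fun q => num ε g m z q / den ε q) p +
      pp (-1) (fun q => num ε g m z q / den ε q) p) :=
  corr_eq_pp hε (by omega) hp (fun _ ha => num_meromorphicAt h ih hz ha)
    (fun a _ => (eventually_generic a).mono fun _ hq => num_inv h ih hz hq)
    (fun a _ => (eventually_generic a).mono fun _ hq => dinv_mul_bracket h ih hz hq)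

/-- The inductive step of `isStableForm`, at one ramification point. -/
theorem exists_pp_num {ε : ℂ} (hε : ε ≠ 0) {g m : ℕ} (h : 3 ≤ 2 * g + m)
    (ih : ∀ g' m', 2 ≤ 2 * g' + m' → 2 * g' + m' < 2 * g + m → IsStableForm ε g' m')
    {a : ℂ} (ha : a ^ 2 = 1) :
    ∃ F ∈ Mix 2 (Finset.univ : Finset (Fin m)), ∀ p z, p ^ 2 ≠ 1 → (∀ i, z i ^ 2 ≠ 1) →
      pp a (fun q => num ε g m z q / den ε q) p = F p z := by
  obtain ⟨G, hG, F, hF, hE⟩ := exists_num_eq h ih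
  choose Q hQ hQe using fun i => Mix.exists_pp_oddB hε (hF i) ha
  refine ⟨(∑ i, (2 : ℂ) • Q i) + fun p z => pp a (fun q => G q z / den ε q) p,
    Submodule.add_mem _ (Submodule.sum_mem _ fun i _ => Submodule.smul_mem _ _ (hQ i))
      (Mix.pp_mem hε hG ha), fun p z hp hz => ?_⟩
  have hm := fun i => Mix.oddB_meromorphicAt hε (hF i) ha z (hz i)
  have h1 : pp a (fun q => num ε g m z q / den ε q) p =
      pp a (fun q => (∑ i, 2 * (oddB q (z i) * F i q z / den ε q)) + G q z / den ε q) p := by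
    refine pp_congr ?_ p
    filter_upwards [eventually_sq_ne_one a] with q hq
    rw [(hE z hz q hq.2).2, add_div, Finset.sum_div]
    congr 1
    exact Finset.sum_congr rfl fun i _ => by ring
  rw [h1, pp_add (MeromorphicAt.fun_sum fun i _ => MeromorphicAt.const_mul (hm i) 2)
    (Mix.div_den_meromorphicAt hε hG ha z), pp_sum fun i _ => MeromorphicAt.const_mul (hm i) 2]
  simp only [Pi.add_apply, Finset.sum_apply, Pi.smul_apply, smul_eq_mul]
  congr 1
  exact Finset.sum_congr rfl fun i _ => by rw [pp_const_mul (hm i), hQe i p z hp hz]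

theorem isStableForm_of_pp {ε : ℂ} {g m : ℕ} {N : (Fin m → ℂ) → ℂ → ℂ}
    (h : ∀ a : ℂ, a ^ 2 = 1 → ∃ F ∈ Mix 2 (Finset.univ : Finset (Fin m)), ∀ p z, p ^ 2 ≠ 1 →
      (∀ i, z i ^ 2 ≠ 1) → pp a (fun q => N z q / den ε q) p = F p z)
    (hc : ∀ p z, p ^ 2 ≠ 1 → (∀ i, z i ^ 2 ≠ 1) → corr ε g m p z =
      -(pp 1 (fun q => N z q / den ε q) p + pp (-1) (fun q => N z q / den ε q) p)) :
    IsStableForm ε g m := by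
  obtain ⟨F, hF, h1⟩ := h 1 (one_pow 2)
  obtain ⟨F', hF', h1'⟩ := h (-1) (by norm_num)
  refine ⟨-(F + F'), Submodule.neg_mem _ (Submodule.add_mem _ hF hF'), fun p z hp hz => ?_⟩
  rw [hc p z hp hz, h1 p z hp hz, h1' p z hp hz]
  rfl

/-! ### The cases `(g, n) = (1, 1)` and `(0, 3)` -/

theorem one_div_sq_sub_one_mem_form : (fun q : ℂ => 1 / (q ^ 2 - 1) ^ 2) ∈ Form 4 := by
  refine ⟨fun z hz => ?_, fun a _ => by fun_prop, fun z hz => ?_⟩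
  · have : z ^ 2 - 1 ≠ 0 := sub_ne_zero.2 hz
    fun_prop (disch := positivity)
  · have h1 : (z⁻¹) ^ 2 - 1 = -(z ^ 2 - 1) / z ^ 2 := by
      field_simp
      ring
    simp only [h1]
    rw [div_pow, neg_sq]
    field_simp

theorem dinv_mul_bracket_one_zero (ε : ℂ) (z : Fin 0 → ℂ) {q : ℂ} (hq : q ≠ 0) :
    dinv q * bracket ε 1 0 z q = -(1 / (q ^ 2 - 1) ^ 2) := by
  have h1 : ∑ h ∈ Finset.range (1 + 1), ∑ J : Finset (Fin 0),
      (if (h = 0 ∧ J.card = 0) ∨ (1 - h = 0 ∧ Jᶜ.card = 0) then 0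
      else corr ε h J.card q (sub z J) * corr ε (1 - h) Jᶜ.card (inv q) (sub z Jᶜ)) = 0 := by
    refine Finset.sum_eq_zero fun h hh => Finset.sum_eq_zero fun J _ => if_pos ?_
    have h2 := J.card_le_univ
    have h3 := Jᶜ.card_le_univ
    simp only [Fintype.card_fin] at h2 h3
    rw [Finset.mem_range] at hh
    omega
  rw [bracket, h1, if_neg one_ne_zero, add_zero, corr_zero_one ε rfl, dinv, B]
  change _ * (1 / (q - inv q) ^ 2) = _
  have h2 : q - inv q = (q ^ 2 - 1) / q := by
    rw [inv]
    field_simp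
  rw [h2, div_pow]
  field_simp

theorem corr_one_zero {ε : ℂ} (hε : ε ≠ 0) {p : ℂ} (hp : p ^ 2 ≠ 1) (z : Fin 0 → ℂ) :
    corr ε 1 0 p z = -(pp 1 (fun q => 1 / (q ^ 2 - 1) ^ 2 / den ε q) p +
      pp (-1) (fun q => 1 / (q ^ 2 - 1) ^ 2 / den ε q) p) :=
  corr_eq_pp hε (H := fun q => 1 / (q ^ 2 - 1) ^ 2) (by omega) hp
    (fun _ ha => Form.meromorphicAt one_div_sq_sub_one_mem_form ha)
    (fun a _ => (eventually_ne_punctured a 0).mono fun _ hq =>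
      Form.inv_eq one_div_sq_sub_one_mem_form hq)
    (fun a _ => (eventually_ne_punctured a 0).mono fun _ hq => dinv_mul_bracket_one_zero ε z hq)

theorem isStableForm_one_zero {ε : ℂ} (hε : ε ≠ 0) : IsStableForm ε 1 0 := by
  refine isStableForm_of_pp (N := fun _ q => 1 / (q ^ 2 - 1) ^ 2) (fun a ha => ?_)
    (fun p z hp _ => corr_one_zero hε hp z)
  have h1 := Mix.of (m := 0) (S := Finset.univ) one_div_sq_sub_one_mem_form (g := fun _ => 0)
    (fun i => i.elim0)
  refine ⟨_, Mix.pp_mem hε h1 ha, fun p z _ _ => ?_⟩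
  simp

theorem dinv_mul_bracket_zero_two (ε : ℂ) (z : Fin 2 → ℂ) {q : ℂ} (hq : q ≠ 0) :
    dinv q * bracket ε 0 2 z q =
      -(1 / (q - z 0) ^ 2 * (1 / (1 - q * z 1) ^ 2) +
        1 / (q - z 1) ^ 2 * (1 / (1 - q * z 0) ^ 2)) := by
  have h1 : ∑ J : Finset (Fin 2),
      (if (0 = 0 ∧ J.card = 0) ∨ (0 - 0 = 0 ∧ Jᶜ.card = 0) then 0
      else corr ε 0 J.card q (sub z J) * corr ε (0 - 0) Jᶜ.card (inv q) (sub z Jᶜ)) =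
      ∑ J : Finset (Fin 2), if J.card = 1 then
        corr ε 0 J.card q (sub z J) * corr ε 0 Jᶜ.card (inv q) (sub z Jᶜ) else 0 := by
    refine Finset.sum_congr rfl fun J _ => ?_
    have hJ : J.card + Jᶜ.card = 2 := by
      rw [Finset.card_add_card_compl, Fintype.card_fin]
    by_cases h : J.card = 1
    · rw [if_pos h, if_neg (by omega)]
    · rw [if_neg h, if_pos (by omega)]
  have h2 : ({0} : Finset (Fin 2))ᶜ = {1} := by decide
  have h3 : ({1} : Finset (Fin 2))ᶜ = {0} := by decide
  rw [bracket, if_pos rfl, zero_add, zero_add, Finset.sum_range_one, h1, sum_card_one,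
    Fin.sum_univ_two, h2, h3, corr_singleton, corr_singleton, corr_singleton, corr_singleton]
  have h4 := dinv_mul_B_inv hq (z 0)
  have h5 := dinv_mul_B_inv hq (z 1)
  simp only [B] at h4 h5 ⊢
  linear_combination 1 / (q - z 0) ^ 2 * h5 + 1 / (q - z 1) ^ 2 * h4

/-- For `ω_{0,3}`, the product of the even parts of `B` vanishes to the order of the kernel
denominator, so only the product of the odd parts has a principal part. -/
theorem corr_zero_two {ε : ℂ} (hε : ε ≠ 0) {p : ℂ} (hp : p ^ 2 ≠ 1) {z : Fin 2 → ℂ}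
    (hz : ∀ i, z i ^ 2 ≠ 1) :
    corr ε 0 2 p z = -(pp 1 (fun q => 2 * oddB q (z 0) * oddB q (z 1) / den ε q) p +
      pp (-1) (fun q => 2 * oddB q (z 0) * oddB q (z 1) / den ε q) p) := by
  have hne : ∀ a : ℂ, a ^ 2 = 1 → ∀ i, a - z i ≠ 0 ∧ 1 - a * z i ≠ 0 := by
    refine fun a ha i => ⟨sub_ne_zero.2 fun h => hz i (h ▸ ha), sub_ne_zero.2 fun h => hz i ?_⟩
    have : z i ^ 2 = (a * z i) ^ 2 := by rw [mul_pow, ha, one_mul]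
    rw [this, ← h, one_pow]
  have hA : ∀ a : ℂ, a ^ 2 = 1 → AnalyticAt ℂ (fun q =>
      1 / (q - z 0) ^ 2 * (1 / (1 - q * z 1) ^ 2) +
      1 / (q - z 1) ^ 2 * (1 / (1 - q * z 0) ^ 2)) a := by
    intro a ha
    obtain ⟨h1, h2⟩ := hne a ha 0
    obtain ⟨h3, h4⟩ := hne a ha 1
    fun_prop (disch := positivity)
  have h1 := corr_eq_pp hε (g := 0) (m := 2) (by omega) hp (z := z)
    (fun a ha => (hA a ha).meromorphicAt)
    (fun a _ => (eventually_ne_punctured a 0).mono fun q hq => by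
      have e1 : ∀ w : ℂ, q⁻¹ - w = (1 - q * w) / q := fun w => by field_simp
      have e2 : ∀ w : ℂ, 1 - q⁻¹ * w = (q - w) / q := fun w => by field_simp
      simp only [e1, e2, div_pow]
      field_simp
      ring)
    (fun a _ => (eventually_ne_punctured a 0).mono fun q hq => dinv_mul_bracket_zero_two ε z hq)
  have h2 : ∀ a : ℂ, a ^ 2 = 1 → pp a (fun q => (1 / (q - z 0) ^ 2 * (1 / (1 - q * z 1) ^ 2) +
      1 / (q - z 1) ^ 2 * (1 / (1 - q * z 0) ^ 2)) / den ε q) p =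
      pp a (fun q => 2 * oddB q (z 0) * oddB q (z 1) / den ε q) p := by
    intro a ha
    have hpa : p ≠ a := by
      rintro rfl
      exact hp ha
    obtain ⟨h1, h2⟩ := hne a ha 0
    obtain ⟨h3, h4⟩ := hne a ha 1
    obtain ⟨u, hu, he⟩ := exists_den_inv_eq hε ha
    have hm : MeromorphicAt (fun q => 2 * oddB q (z 0) * oddB q (z 1) / den ε q) a :=
      (((MeromorphicAt.const 2 a).fun_mul (oddB_analyticAt_of_sq ha (hz 0)).meromorphicAt).fun_mul
        (oddB_analyticAt_of_sq ha (hz 1)).meromorphicAt).fun_div (den_meromorphicAt hε ha)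
    -- `1/(q-w)² - 1/(1-qw)² = (1-q²)(1-w²) / ((q-w)²(1-qw)²)` for `w = z 0` and `w = z 1`: the
    -- product of the two has a double zero at `a`, as does `den`
    have hR : AnalyticAt ℂ (fun q => -(1 / 2) * (1 - z 0 ^ 2) * (1 - z 1 ^ 2) * (q + a) ^ 2 * u q /
        ((q - z 0) ^ 2 * (1 - q * z 0) ^ 2 * (q - z 1) ^ 2 * (1 - q * z 1) ^ 2)) a := by
      have : (a - z 0) ^ 2 * (1 - a * z 0) ^ 2 * (a - z 1) ^ 2 * (1 - a * z 1) ^ 2 ≠ 0 := by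
        positivity
      fun_prop (disch := assumption)
    rw [← add_zero (pp a (fun q => 2 * oddB q (z 0) * oddB q (z 1) / den ε q) p),
      ← pp_of_analyticAt hR hpa, ← pp_add hm hR.meromorphicAt]
    refine pp_congr ?_ p
    have hc : ∀ w : ℂ, a - w ≠ 0 → 1 - a * w ≠ 0 → ∀ᶠ q in 𝓝[≠] a, q - w ≠ 0 ∧ 1 - q * w ≠ 0 := by
      intro w hw1 hw2
      have c1 : ContinuousAt (fun q : ℂ => q - w) a := by fun_prop
      have c2 : ContinuousAt (fun q : ℂ => 1 - q * w) a := by fun_prop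
      exact ((c1.eventually_ne hw1).and (c2.eventually_ne hw2)).filter_mono nhdsWithin_le_nhds
    filter_upwards [he, eventually_ne_punctured a a, hc _ h1 h2, hc _ h3 h4]
      with q e1 e2 ⟨e3, e4⟩ ⟨e5, e6⟩
    have e7 : q - a ≠ 0 := sub_ne_zero.2 e2
    have e8 : (q - a) ^ 2 * (q + a) ^ 2 = (q ^ 2 - 1) ^ 2 := by
      rw [← mul_pow]
      congr 1
      linear_combination -ha
    rw [div_eq_mul_inv, div_eq_mul_inv _ (den ε q), e1, oddB, oddB]
    have e9 : (q + a) ^ 2 = (q ^ 2 - 1) ^ 2 / (q - a) ^ 2 := by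
      rw [← e8]
      field_simp
    rw [e9]
    field_simp
    ring
  rw [h1, h2 1 (one_pow 2), h2 (-1) (by norm_num)]

theorem isStableForm_zero_two {ε : ℂ} (hε : ε ≠ 0) : IsStableForm ε 0 2 := by
  refine isStableForm_of_pp (N := fun z q => 2 * oddB q (z 0) * oddB q (z 1)) (fun a ha => ?_)
    (fun p z hp hz => corr_zero_two hε hp hz)
  have hnega : (-a) ^ 2 = 1 := by rw [neg_sq, ha]
  have hff := Form.mul (basisForm_mem ha 0) (basisForm_mem ha 0)
  have hm : MeromorphicAt (fun q => basisForm a 0 q * basisForm a 0 q / den ε q) a :=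
    (Form.meromorphicAt hff ha).div (den_meromorphicAt hε ha)
  refine ⟨_, Submodule.smul_mem _ 32 (Mix.of (m := 2) (S := Finset.univ)
    (pp_div_den_mem_form hε ha (Form.meromorphicAt hff ha)
      ((eventually_ne_punctured a 0).mono fun q hq => Form.inv_eq hff hq))
    (g := fun _ => basisForm (-a) 0) (fun _ => basisForm_mem hnega 0)), fun p z hp hz => ?_⟩
  have hpa : p ≠ a := by
    rintro rfl
    exact hp ha
  obtain ⟨u, hu, he⟩ := exists_den_inv_eq hε ha
  obtain ⟨r, hr, hre⟩ := oddB_expansion ha (hz 0) 1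
  obtain ⟨s, hs, hse⟩ := oddB_expansion ha (hz 1) 1
  have ho := oddB_analyticAt_of_sq ha (hz 1)
  have hb : AnalyticAt ℂ (basisForm a 0) a := by
    have h0 : a + a ≠ 0 := by
      rw [← two_mul]
      exact mul_ne_zero two_ne_zero (ne_zero_of_sq ha)
    unfold basisForm
    fun_prop (disch := positivity)
  have hR : AnalyticAt ℂ (fun q => 2 * u q * (r q * oddB q (z 1) +
      4 * basisForm a 0 q * basisForm (-a) 0 (z 0) * s q)) a := by fun_prop
  have h1 : pp a (fun q => 2 * oddB q (z 0) * oddB q (z 1) / den ε q) p =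
      pp a (fun q => 32 * (basisForm (-a) 0 (z 0) * basisForm (-a) 0 (z 1)) *
        (basisForm a 0 q * basisForm a 0 q / den ε q) + 2 * u q * (r q * oddB q (z 1) +
          4 * basisForm a 0 q * basisForm (-a) 0 (z 0) * s q)) p := by
    refine pp_congr ?_ p
    filter_upwards [he, hre, hse, eventually_ne_punctured a a] with q e1 e2 e3 e4
    have e7 : q - a ≠ 0 := sub_ne_zero.2 e4
    rw [div_eq_mul_inv, div_eq_mul_inv _ (den ε q), e1, e2, e3]
    simp only [Finset.sum_range_one, Nat.cast_zero]
    field_simp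
    ring
  rw [h1, pp_add (hm.const_mul _) hR.meromorphicAt, pp_of_analyticAt hR hpa, pp_const_mul hm]
  simp only [Pi.smul_apply, smul_eq_mul, Fin.prod_univ_two]
  ring

/-- By induction on `2g + m`, through the recursion in the form `corr_eq_pp_num`. -/
theorem isStableForm {ε : ℂ} (hε : ε ≠ 0) (g m : ℕ) (h : 2 ≤ 2 * g + m) : IsStableForm ε g m := by
  induction hn : 2 * g + m using Nat.strong_induction_on generalizing g m with
  | _ n ih =>
    by_cases h3 : 3 ≤ 2 * g + m
    · have ih' : ∀ g' m', 2 ≤ 2 * g' + m' → 2 * g' + m' < 2 * g + m → IsStableForm ε g' m' :=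
        fun g' m' h1 h2 => ih _ (by omega) g' m' h1 rfl
      exact isStableForm_of_pp (fun a ha => exists_pp_num hε h3 ih' ha)
        (fun p z hp hz => corr_eq_pp_num hε h3 ih' hz hp)
    · have h2 : (g = 0 ∧ m = 2) ∨ (g = 1 ∧ m = 0) := by omega
      rcases h2 with ⟨rfl, rfl⟩ | ⟨rfl, rfl⟩
      · exact isStableForm_zero_two hε
      · exact isStableForm_one_zero hε


/-! ### The operator `𝒜` -/

theorem x_inv (q : ℂ) : x q⁻¹ = x q := by
  simp only [x, one_div, inv_inv]
  ring

theorem x_sub_x {z q : ℂ} (hz : z ≠ 0) (hq : q ≠ 0) :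
    x z - x q = -((q - z) * (q - z⁻¹)) / q := by
  simp only [x]
  field_simp
  ring

theorem ne_inv_of_sq {z q : ℂ} (hz : z ^ 2 ≠ 1) (hq : q ^ 2 = 1) : q ≠ z ∧ q ≠ z⁻¹ :=
  ⟨by rintro rfl; exact hz hq, by rintro rfl; exact inv_sq_ne_one hz hq⟩

theorem x_sub_x_ne_zero {z a : ℂ} (hz : Generic z) (ha : a ^ 2 = 1) : x z - x a ≠ 0 := by
  obtain ⟨h1, h2⟩ := ne_inv_of_sq (sq_ne_one hz) ha
  have h0 := ne_zero_of_sq ha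
  rw [x_sub_x hz.1 h0]
  exact div_ne_zero (neg_ne_zero.2 (mul_ne_zero (sub_ne_zero.2 h1) (sub_ne_zero.2 h2))) h0

theorem x_analyticAt {a : ℂ} (ha : a ≠ 0) : AnalyticAt ℂ x a := by
  unfold x
  fun_prop (disch := assumption)

/-- For a form with poles at most at `±1`, the sum over the poles may be extended to both points:
where `f` has no pole, the residue is zero. -/
theorem opA_eq {f : ℂ → ℂ} (hf : ∀ z, z ^ 2 ≠ 1 → AnalyticAt ℂ f z)
    (hm : ∀ a, a ^ 2 = 1 → MeromorphicAt f a) {z : ℂ} (hz : Generic z) :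
    opA f (x z) = residue (fun q => f q * ln q / (x z - x q)) 1 +
      residue (fun q => f q * ln q / (x z - x q)) (-1) := by
  have hterm : ∀ a : ℂ, a ^ 2 = 1 → (∑ᶠ _ : meromorphicOrderAt f a < 0,
      residue (fun q => f q * ln q / (x z - x q)) a) =
        residue (fun q => f q * ln q / (x z - x q)) a := by
    intro a ha
    by_cases h : meromorphicOrderAt f a < 0
    · rw [finsum_eq_if, if_pos h]
    · rw [finsum_eq_if, if_neg h]
      obtain ⟨g, hg, he⟩ :=
        (MeromorphicAt.meromorphicOrderAt_nonneg_iff (hm a ha)).1 (not_lt.1 h)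
      have h0 := ne_zero_of_sq ha
      have h1 := x_sub_x_ne_zero hz ha
      have h2 := ln_analyticAt ha
      have h3 := x_analyticAt h0
      have h4 : AnalyticAt ℂ (fun q => g q * ln q / (x z - x q)) a := by
        fun_prop (disch := assumption)
      rw [← h4.residue_eq_zero]
      exact residue_congr (he.mono fun q hq => by simp only [hq])
  have hsupp : (Function.support fun a => ∑ᶠ _ : meromorphicOrderAt f a < 0,
      residue (fun q => f q * ln q / (x z - x q)) a) ⊆ (({1, -1} : Finset ℂ) : Set ℂ) := by
    intro a ha
    by_contra h
    refine ha ?_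
    have h2 : a ^ 2 ≠ 1 := fun h3 => h (by
      rcases eq_one_or_eq_neg_one_of_sq h3 with rfl | rfl <;> simp)
    beta_reduce
    rw [finsum_eq_if, if_neg (not_lt.2 (hf a h2).meromorphicOrderAt_nonneg)]
  rw [opA, finsum_eq_sum_of_support_subset _ hsupp, Finset.sum_pair (by norm_num),
    hterm 1 (one_pow 2), hterm (-1) (by norm_num)]

/-- The factor `1 / (dx(q) (x(z) - x(q)))`, extended holomorphically to `q = 0`. -/
def cauchyFactor (z q : ℂ) : ℂ := -q ^ 3 / ((q ^ 2 - 1) * ((q - z) * (q - z⁻¹)))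

theorem cauchyFactor_eq {z q : ℂ} (hz : z ≠ 0) (hq : q ≠ 0) :
    cauchyFactor z q = 1 / (dx q * (x z - x q)) := by
  rw [cauchyFactor, dx_eq hq, x_sub_x hz hq]
  rw [neg_div, neg_div, mul_neg, div_neg, div_mul_div_comm, one_div_div]
  congr 2

theorem cauchyFactor_meromorphicAt (z q : ℂ) : MeromorphicAt (cauchyFactor z) q := by
  unfold cauchyFactor
  fun_prop

theorem cauchyFactor_analyticAt {z q : ℂ} (h : q ^ 2 ≠ 1) (h1 : q ≠ z) (h2 : q ≠ z⁻¹) :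
    AnalyticAt ℂ (cauchyFactor z) q := by
  have : (q ^ 2 - 1) * ((q - z) * (q - z⁻¹)) ≠ 0 :=
    mul_ne_zero (sub_ne_zero.2 h) (mul_ne_zero (sub_ne_zero.2 h1) (sub_ne_zero.2 h2))
  unfold cauchyFactor
  fun_prop (disch := assumption)

theorem cauchyFactor_inv {z q : ℂ} (hz : z ≠ 0) (hq : q ≠ 0) :
    cauchyFactor z q⁻¹ = -cauchyFactor z q / q ^ 2 := by
  rw [cauchyFactor_eq hz hq, cauchyFactor_eq hz (inv_ne_zero hq), x_inv, dx_eq hq,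
    dx_eq (inv_ne_zero hq)]
  have h1 : ((q⁻¹) ^ 2 - 1) / (q⁻¹) ^ 2 = -(q ^ 2 - 1) := by
    field_simp
    ring
  rw [h1]
  field_simp

/-- Since `ln` enters only through its odd part `(y(q) - y(1/q)) / (2ε)`, the operator `𝒜` turns the
principal parts of `N / ((y(q) - y(1/q)) dx(q))` back into residues of the rational form
`N / (dx(q) (x(z) - x(q)))`. -/
theorem residue_mul_ln {ε : ℂ} (hε : ε ≠ 0) {z : ℂ} (hz : Generic z) {f : ℂ → ℂ} {N : ℂ → ℂ}
    (hN : ∀ a : ℂ, a ^ 2 = 1 → MeromorphicAt N a)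
    (hf : ∀ p, p ^ 2 ≠ 1 → f p = -(pp 1 (fun q => N q / den ε q) p +
      pp (-1) (fun q => N q / den ε q) p))
    (hinv : ∀ q, Generic q → f q⁻¹ = q ^ 2 * f q) {a : ℂ} (ha : a ^ 2 = 1) :
    residue (fun q => f q * ln q / (x z - x q)) a =
      -(1 / (2 * ε)) * residue (fun q => N q * cauchyFactor z q) a := by
  have h0 := ne_zero_of_sq ha
  have hai := inv_eq_self_of_sq ha
  have h1 := x_sub_x_ne_zero hz ha
  have h3 := x_analyticAt h0
  have hNd : ∀ b : ℂ, b ^ 2 = 1 → MeromorphicAt (fun q => N q / den ε q) b := fun b hb =>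
    (hN b hb).div (den_meromorphicAt hε hb)
  -- `f` and `-N / den` differ by an analytic function
  obtain ⟨g, hg, hge⟩ : ∃ g, AnalyticAt ℂ g a ∧
      ∀ᶠ q in 𝓝[≠] a, f q = -(N q / den ε q) + g q := by
    obtain ⟨g, hg, hge⟩ := exists_eq_pp_add (hNd a ha)
    have hna : a ≠ -a := fun h => h0 (self_eq_neg.1 h)
    have hsq : (-a) ^ 2 = 1 := by rw [neg_sq, ha]
    refine ⟨fun q => g q - pp (-a) (fun q => N q / den ε q) q,
      hg.fun_sub (pp_analyticAt (hNd (-a) hsq) hna), ?_⟩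
    filter_upwards [eventually_ne_punctured a a, eventually_sq_ne_one a] with q h4 h5
    rw [hf q h5.2, hge q h4]
    rcases eq_one_or_eq_neg_one_of_sq ha with rfl | rfl
    · ring
    · rw [neg_neg]
      ring
  have hfm : MeromorphicAt f a := by
    have : MeromorphicAt (fun q => -(N q / den ε q) + g q) a :=
      ((hNd a ha).fun_neg).fun_add hg.meromorphicAt
    exact this.congr (hge.mono fun q hq => hq.symm)
  have hm : MeromorphicAt (fun q => f q * ln q / (x z - x q)) a := by
    have h2 := (ln_analyticAt ha).meromorphicAt
    have h3 := h3.meromorphicAt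
    fun_prop
  have hcm : MeromorphicAt (fun q => N q * cauchyFactor z q) a :=
    (hN a ha).fun_mul (cauchyFactor_meromorphicAt z a)
  -- averaging over `q ↦ 1/q` replaces `ln q` by `(ln q - ln (1/q)) / 2`
  have h4 := residue_inv h0 (f := fun q => f q * ln q / (x z - x q)) (by rwa [hai])
  rw [hai] at h4
  have hm2 : MeromorphicAt
      (fun q => f q⁻¹ * ln q⁻¹ / (x z - x q⁻¹) * (-1 / q ^ 2)) a := by
    have h5 : MeromorphicAt (fun q => f q * ln q / (x z - x q)) a⁻¹ := by rwa [hai]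
    have h6 : MeromorphicAt (fun q => f q⁻¹ * ln q⁻¹ / (x z - x q⁻¹)) a :=
      h5.comp_analyticAt (analyticAt_inv h0)
    fun_prop
  have hdy := dy_analyticAt ε ha
  have hR : AnalyticAt ℂ (fun q => g q * dy ε q / (x z - x q)) a := by
    fun_prop (disch := assumption)
  have h7 : residue (fun q => f q * ln q / (x z - x q) +
      f q⁻¹ * ln q⁻¹ / (x z - x q⁻¹) * (-1 / q ^ 2)) a =
      residue (fun q => (1 / ε) * ((-1) * (N q * cauchyFactor z q) +
        g q * dy ε q / (x z - x q))) a := by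
    refine residue_congr ?_
    filter_upwards [hge, eventually_generic a] with q h8 h9
    have hq0 := h9.1
    have e1 : dy ε q ≠ 0 := dy_ne_zero hε hq0 (sq_ne_one h9)
    have e2 : dx q ≠ 0 := dx_ne_zero hq0 (sq_ne_one h9)
    have e3 : ln q - ln q⁻¹ = dy ε q / ε := by
      rw [dy, y, y, inv_eq_inv]
      field_simp
    have e4 : f q * ln q / (x z - x q) + f q⁻¹ * ln q⁻¹ / (x z - x q⁻¹) * (-1 / q ^ 2) =
        f q * (ln q - ln q⁻¹) / (x z - x q) := by
      rw [hinv q h9, x_inv]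
      field_simp
      ring
    rw [e4, e3, h8, den, cauchyFactor_eq hz.1 hq0]
    field_simp
  rw [residue_add hm hm2, h4, residue_const_mul
    ((hcm.const_mul (-1)).fun_add hR.meromorphicAt), residue_add (hcm.const_mul (-1))
    hR.meromorphicAt, residue_const_mul hcm, hR.residue_eq_zero] at h7
  linear_combination (1 / 2) * h7

/-- `𝒜[ω_{g,1+m}]` as a sum of residues of a rational form at the ramification points. -/
theorem opA_corr {ε : ℂ} (hε : ε ≠ 0) {g m : ℕ} (h : 2 ≤ 2 * g + m) {zs : Fin m → ℂ}
    (hzs : ∀ i, zs i ^ 2 ≠ 1) {z : ℂ} (hz : Generic z) {N : ℂ → ℂ}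
    (hN : ∀ a : ℂ, a ^ 2 = 1 → MeromorphicAt N a)
    (hc : ∀ p, p ^ 2 ≠ 1 → corr ε g m p zs = -(pp 1 (fun q => N q / den ε q) p +
      pp (-1) (fun q => N q / den ε q) p)) :
    opA (fun u => corr ε g m u zs) (x z) =
      -(1 / (2 * ε)) * (residue (fun q => N q * cauchyFactor z q) 1 +
        residue (fun q => N q * cauchyFactor z q) (-1)) := by
  obtain ⟨F, hF, hFe⟩ := isStableForm hε g m h
  have hinv : ∀ q, Generic q → corr ε g m q⁻¹ zs = q ^ 2 * corr ε g m q zs := by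
    intro q hq
    rw [← inv_eq_inv]
    exact IsStableForm.inv_apply ⟨F, hF, hFe⟩ hq hzs
  rw [opA_eq _ _ hz, residue_mul_ln hε hz hN hc hinv (one_pow 2),
    residue_mul_ln hε hz hN hc hinv (by norm_num)]
  · ring
  · intro p hp
    refine (Form.analyticAt (Mix.form hF zs) hp).congr ?_
    have : ∀ᶠ q in 𝓝 p, q ^ 2 ≠ 1 :=
      (continuous_pow 2).continuousAt.eventually_ne hp
    exact this.mono fun q hq => (hFe q zs hq hzs).symm
  · intro a ha
    refine (Form.meromorphicAt (Mix.form hF zs) ha).congr ?_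
    exact (eventually_sq_ne_one a).mono fun q hq => (hFe q zs hq.2 hzs).symm

/-! ### Moving the residues away from the ramification points -/

theorem residue_mul_cauchyFactor_self {N : ℂ → ℂ} {z : ℂ} (hz : Generic z)
    (hN : AnalyticAt ℂ N z) :
    residue (fun q => N q * cauchyFactor z q) z = -N z / dx z ^ 2 := by
  have h0 := hz.1
  have h1 : z ^ 2 - 1 ≠ 0 := sub_ne_zero.2 (sq_ne_one hz)
  have h2 : z - z⁻¹ = (z ^ 2 - 1) / z := by field_simp
  have h3 : z - z⁻¹ ≠ 0 := by
    rw [h2]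
    exact div_ne_zero h1 h0
  have h4 : AnalyticAt ℂ (fun q => N q * (-q ^ 3 / ((q ^ 2 - 1) * (q - z⁻¹)))) z := by
    have := mul_ne_zero h1 h3
    fun_prop (disch := assumption)
  have h5 : (fun q => N q * cauchyFactor z q) =
      fun q => N q * (-q ^ 3 / ((q ^ 2 - 1) * (q - z⁻¹))) / (q - z) := by
    funext q
    rw [cauchyFactor, mul_div_assoc, div_div, mul_assoc, mul_comm (q - z⁻¹)]
  rw [h5, residue_simple h4, h2, dx_eq h0]
  field_simp

/-- The residue theorem for `N / (dx (x(z) - x))`, where `N` is an even quadratic differential whose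
poles are the ramification points, the points of `W` and their inverses. -/
theorem sum_residue_mul_cauchyFactor {N : ℂ → ℂ} {W : Finset ℂ} {z : ℂ} (hz : Generic z)
    (hW : ∀ w ∈ W, Generic w ∧ w⁻¹ ∉ W) (hzW : z ∉ W) (hzW' : z⁻¹ ∉ W)
    (hN : ∀ q, q ^ 2 ≠ 1 → q ∉ W → q⁻¹ ∉ W → AnalyticAt ℂ N q) (hm : ∀ q, MeromorphicAt N q)
    (hinv : ∀ q, q ≠ 0 → N q⁻¹ = q ^ 4 * N q) :
    residue (fun q => N q * cauchyFactor z q) 1 + residue (fun q => N q * cauchyFactor z q) (-1) =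
      2 * N z / dx z ^ 2 - 2 * ∑ w ∈ W, residue (fun q => N q * cauchyFactor z q) w := by
  classical
  have h0 := hz.1
  have hzne : z ≠ z⁻¹ := by
    intro h
    refine sq_ne_one hz ?_
    rw [sq]
    nth_rewrite 2 [h]
    exact mul_inv_cancel₀ h0
  have hfm : ∀ q, MeromorphicAt (fun q => N q * cauchyFactor z q) q := fun q =>
    (hm q).fun_mul (cauchyFactor_meromorphicAt z q)
  -- the form is invariant under `q ↦ 1/q`, so the residues at `q` and `1/q` agree
  have hres : ∀ q, q ≠ 0 → residue (fun q => N q * cauchyFactor z q) q⁻¹ =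
      residue (fun q => N q * cauchyFactor z q) q := by
    intro q hq
    rw [← residue_inv hq (hfm _)]
    refine residue_congr ?_
    filter_upwards [eventually_ne_punctured q 0] with t ht
    rw [hinv t ht, cauchyFactor_inv h0 ht]
    field_simp
  have h0W : (0 : ℂ) ∉ W := fun h => (hW 0 h).1.1 rfl
  -- in the coordinate `v = 1/q` at infinity
  have hinf : Tendsto (fun q => q * (N q * cauchyFactor z q)) (cocompact ℂ) (𝓝 0) := by
    have hN0 : AnalyticAt ℂ N 0 := hN 0 (by norm_num) h0W (by simpa using h0W)
    have hc : ContinuousAt (fun v : ℂ => -N v * v ^ 4 /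
        ((1 - v ^ 2) * ((1 - v * z) * (1 - v * z⁻¹)))) 0 := by
      have := hN0.continuousAt
      have h1 : ((1 : ℂ) - 0 ^ 2) * ((1 - 0 * z) * (1 - 0 * z⁻¹)) ≠ 0 := by simp
      fun_prop (disch := assumption)
    have ht : Tendsto (fun q : ℂ => q⁻¹) (cocompact ℂ) (𝓝 0) := by
      rw [← Metric.cobounded_eq_cocompact]
      exact tendsto_inv₀_cobounded
    have h2 := hc.tendsto.comp ht
    simp only [ne_eq, OfNat.ofNat_ne_zero, not_false_eq_true, zero_pow, mul_zero, zero_div] at h2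
    refine h2.congr' ?_
    have hne : ∀ᶠ q in cocompact ℂ, q ≠ (0 : ℂ) := isCompact_singleton.compl_mem_cocompact
    filter_upwards [hne] with q hq
    have e1 : 1 - q⁻¹ ^ 2 = (q ^ 2 - 1) / q ^ 2 := by field_simp
    have e2 : ∀ w : ℂ, 1 - q⁻¹ * w = (q - w) / q := fun w => by field_simp
    simp only [Function.comp_apply, e1, e2]
    rw [hinv q hq, cauchyFactor]
    field_simp
  let S : Finset ℂ := (({1, -1} : Finset ℂ) ∪ {z, z⁻¹}) ∪ (W ∪ W.image fun w => w⁻¹)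
  have hS := sum_residue_eq_zero (S := S) (fun a _ => hfm a) (fun q hq => by
    simp only [S, Finset.mem_union, Finset.mem_insert, Finset.mem_singleton, Finset.mem_image,
      not_or, not_exists, not_and] at hq
    obtain ⟨⟨⟨a1, a2⟩, a3, a4⟩, a5, a6⟩ := hq
    have hq2 : q ^ 2 ≠ 1 := fun h =>
      (eq_one_or_eq_neg_one_of_sq h).elim a1 a2
    exact (hN q hq2 a5 fun h => a6 _ h (inv_inv q)).fun_mul
      (cauchyFactor_analyticAt hq2 a3 a4)) hinf
  have d1 : Disjoint (({1, -1} : Finset ℂ) ∪ {z, z⁻¹}) (W ∪ W.image fun w => w⁻¹) := by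
    rw [Finset.disjoint_left]
    intro q hq hq'
    simp only [Finset.mem_union, Finset.mem_insert, Finset.mem_singleton, Finset.mem_image]
      at hq hq'
    rcases hq' with hq' | ⟨w, hw, rfl⟩
    · rcases hq with (rfl | rfl) | (rfl | rfl)
      · exact (hW _ hq').1.2.1 rfl
      · exact (hW _ hq').1.2.2 rfl
      · exact hzW hq'
      · exact hzW' hq'
    · have hw1 := inv_sq_ne_one (sq_ne_one (hW _ hw).1)
      rcases hq with (h | h) | (h | h)
      · exact hw1 (by rw [h, one_pow])
      · exact hw1 (by rw [h]; norm_num)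
      · exact hzW' (by rwa [← h, inv_inv])
      · exact hzW (by rwa [← inv_injective h])
  have d2 : Disjoint ({1, -1} : Finset ℂ) {z, z⁻¹} := by
    rw [Finset.disjoint_left]
    intro q hq hq'
    simp only [Finset.mem_insert, Finset.mem_singleton] at hq hq'
    have hq2 : q ^ 2 = 1 := by rcases hq with rfl | rfl <;> norm_num
    have := ne_inv_of_sq (sq_ne_one hz) hq2
    exact hq'.elim this.1 this.2
  have d3 : Disjoint W (W.image fun w => w⁻¹) := by
    rw [Finset.disjoint_left]
    intro q hq hq'
    obtain ⟨w, hw, rfl⟩ := Finset.mem_image.1 hq'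
    exact (hW w hw).2 hq
  rw [Finset.sum_union d1, Finset.sum_union d2, Finset.sum_union d3,
    Finset.sum_pair (by norm_num), Finset.sum_pair hzne,
    Finset.sum_image fun _ _ _ _ h => inv_injective h, hres z h0,
    residue_mul_cauchyFactor_self hz (hN z (sq_ne_one hz) hzW hzW'),
    Finset.sum_congr (g := fun w => residue (fun q => N q * cauchyFactor z q) w) rfl
      fun w hw => hres w (hW w hw).1.1] at hS
  linear_combination hS

/-- The odd part of `B(q, w)` has a double pole at `q = w`, which produces the derivative in
`dTerm`. -/
theorem residue_oddB_mul {f : ℂ → ℂ} {w z : ℂ} (hw : Generic w) (hz : z ≠ 0) (h1 : w ≠ z)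
    (h2 : w ≠ z⁻¹) (hf : AnalyticAt ℂ f w) :
    residue (fun q => 2 * oddB q w * f q * cauchyFactor z q) w =
      deriv (fun u => 1 / (x z - x u) * (f u / dx u)) w := by
  have hc := cauchyFactor_analyticAt (sq_ne_one hw) h1 h2
  have hg : AnalyticAt ℂ (fun q => f q * cauchyFactor z q) w := hf.fun_mul hc
  have h3 : 1 - w * w ≠ 0 := by
    rw [← sq]
    exact sub_ne_zero.2 (sq_ne_one hw).symm
  have hR : AnalyticAt ℂ (fun q => 1 / (1 - q * w) ^ 2 * (f q * cauchyFactor z q)) w := by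
    fun_prop (disch := positivity)
  have hm : MeromorphicAt (fun q => f q * cauchyFactor z q / (q - w) ^ 2) w := by
    have := hg.meromorphicAt
    fun_prop
  have h4 : (fun q => 2 * oddB q w * f q * cauchyFactor z q) =
      fun q => f q * cauchyFactor z q / (q - w) ^ 2 +
        1 / (1 - q * w) ^ 2 * (f q * cauchyFactor z q) := by
    funext q
    rw [oddB]
    ring
  rw [h4, residue_add hm hR.meromorphicAt, residue_double hg, hR.residue_eq_zero, add_zero]
  refine Filter.EventuallyEq.deriv_eq ?_
  filter_upwards [isOpen_ne.mem_nhds hw.1] with q hq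
  rw [cauchyFactor_eq hz hq, div_mul_div_comm, one_mul, mul_one_div, mul_comm (dx q)]

theorem dTerm_eq {F f : ℂ → ℂ} {z w : ℂ} (h : F =ᶠ[𝓝 w] f) :
    dTerm F z w = dx z * deriv (fun u => 1 / (x z - x u) * (f u / dx u)) w := by
  rw [dTerm, ← deriv_const_mul_field]
  refine Filter.EventuallyEq.deriv_eq ?_
  filter_upwards [h] with q hq
  rw [hq]
  ring

theorem Apart.ne_inv {z w : ℂ} (h : Apart z w) (hz : z ≠ 0) : w ≠ z⁻¹ := by
  rintro rfl
  exact h.2 (mul_inv_cancel₀ hz)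

theorem inv_notMem_singleton {w : ℂ} (hw : Generic w) : w⁻¹ ∉ ({w} : Finset ℂ) := by
  rw [Finset.mem_singleton]
  intro h
  refine sq_ne_one hw ?_
  rw [sq]
  nth_rewrite 1 [← h]
  exact inv_mul_cancel₀ hw.1

theorem oddB_meromorphicAt (q w : ℂ) : MeromorphicAt (fun q => oddB q w) q := by
  unfold oddB
  fun_prop

theorem oddB_analyticAt_inv {q w : ℂ} (h1 : q ≠ w) (h2 : q⁻¹ ≠ w) :
    AnalyticAt ℂ (fun q => oddB q w) q :=
  oddB_analyticAt h1 fun h => h2 (inv_eq_of_mul_eq_one_right h)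

theorem Form.meromorphicAt_all {k : ℕ} {f : ℂ → ℂ} (hf : f ∈ Form k) (q : ℂ) :
    MeromorphicAt f q := by
  by_cases h : q ^ 2 = 1
  · exact Form.meromorphicAt hf h
  · exact (Form.analyticAt hf h).meromorphicAt

theorem sum_residue_form {G : ℂ → ℂ} (hG : G ∈ Form 4) {z : ℂ} (hz : Generic z) :
    residue (fun q => G q * cauchyFactor z q) 1 + residue (fun q => G q * cauchyFactor z q) (-1) =
      2 * G z / dx z ^ 2 := by
  have := sum_residue_mul_cauchyFactor (W := ∅) hz (by simp) (by simp) (by simp)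
    (fun q hq _ _ => Form.analyticAt hG hq) (Form.meromorphicAt_all hG)
    (fun q hq => Form.inv_eq hG hq)
  simpa using this

theorem sum_residue_oddB_mul_form {f : ℂ → ℂ} (hf : f ∈ Form 2) {z w : ℂ} (hz : Generic z)
    (hw : Generic w) (hzw : Apart z w) :
    residue (fun q => 2 * oddB q w * f q * cauchyFactor z q) 1 +
      residue (fun q => 2 * oddB q w * f q * cauchyFactor z q) (-1) =
      2 * (2 * oddB z w * f z) / dx z ^ 2 -
        2 * deriv (fun u => 1 / (x z - x u) * (f u / dx u)) w := by
  have h := sum_residue_mul_cauchyFactor (N := fun q => 2 * oddB q w * f q) (W := {w}) hz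
    (fun v hv => by
      obtain rfl := Finset.mem_singleton.1 hv
      exact ⟨hw, inv_notMem_singleton hw⟩)
    (fun h => hzw.1 (Finset.mem_singleton.1 h))
    (fun h => (hzw.ne_inv hz.1) (Finset.mem_singleton.1 h).symm)
    (fun q hq h1 h2 => (analyticAt_const.fun_mul (oddB_analyticAt_inv
      (fun h => h1 (Finset.mem_singleton.2 h)) fun h => h2 (Finset.mem_singleton.2 h))).fun_mul
        (Form.analyticAt hf hq))
    (fun q => ((MeromorphicAt.const 2 q).fun_mul (oddB_meromorphicAt q w)).fun_mul
      (Form.meromorphicAt_all hf q))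
    (fun q hq => by
      rw [oddB_inv hq, Form.inv_eq hf hq]
      ring)
  rwa [Finset.sum_singleton, residue_oddB_mul hw hz.1 hzw.1.symm (hzw.ne_inv hz.1)
    (Form.analyticAt hf (sq_ne_one hw))] at h

/-- The case `2g - 2 + n ≥ 2`. The residue theorem is applied to each summand of `num` separately,
so that the `zᵢ` may coincide with or be inverse to one another. -/
theorem opA_corr_mul_dx {ε : ℂ} (hε : ε = 1 ∨ ε = -1) {g m : ℕ} (h : 3 ≤ 2 * g + m) {z₁ : ℂ}
    {z : Fin m → ℂ} (hz₁ : Generic z₁) (hz : ∀ i, Generic (z i)) (hA : ∀ i, Apart z₁ (z i)) :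
    opA (fun u => corr ε g m u z) (x z₁) * dx z₁ =
      -ε * (num ε g m z z₁ / dx z₁ - ∑ i, dTerm (fun u => corr ε g (Finset.univ.erase i).card u
        (sub z (Finset.univ.erase i))) z₁ (z i)) := by
  have hε0 : ε ≠ 0 := by rcases hε with rfl | rfl <;> norm_num
  have hε1 : 1 / (2 * ε) = ε / 2 := by rcases hε with rfl | rfl <;> norm_num
  have hdx := dx_ne_zero hz₁.1 (sq_ne_one hz₁)
  have hz2 : ∀ i, z i ^ 2 ≠ 1 := fun i => sq_ne_one (hz i)
  have ih : ∀ g' m', 2 ≤ 2 * g' + m' → 2 * g' + m' < 2 * g + m → IsStableForm ε g' m' :=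
    fun g' m' h1 _ => isStableForm hε0 g' m' h1
  obtain ⟨G, hG, F, hF, hE⟩ := exists_num_eq h ih
  have hm : ∀ i, ∀ a : ℂ,
      MeromorphicAt (fun q => 2 * oddB q (z i) * F i q z * cauchyFactor z₁ q) a :=
    fun i a => (((MeromorphicAt.const 2 a).fun_mul (oddB_meromorphicAt a _)).fun_mul
      (Form.meromorphicAt_all (Mix.form (hF i) z) a)).fun_mul (cauchyFactor_meromorphicAt z₁ a)
  have hres : ∀ a : ℂ, residue (fun q => num ε g m z q * cauchyFactor z₁ q) a =
      (∑ i, residue (fun q => 2 * oddB q (z i) * F i q z * cauchyFactor z₁ q) a) +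
        residue (fun q => G q z * cauchyFactor z₁ q) a := by
    intro a
    rw [← residue_sum fun i _ => hm i a, ← residue_add (MeromorphicAt.fun_sum fun i _ => hm i a)
      ((Form.meromorphicAt_all (Mix.form hG z) a).fun_mul (cauchyFactor_meromorphicAt z₁ a))]
    refine residue_congr ?_
    filter_upwards [eventually_sq_ne_one a] with q hq
    rw [(hE z hz2 q hq.2).2, add_mul, Finset.sum_mul]
  have hd : ∀ i, dTerm (fun u => corr ε g (Finset.univ.erase i).card u
      (sub z (Finset.univ.erase i))) z₁ (z i) =
      dx z₁ * deriv (fun u => 1 / (x z₁ - x u) * (F i u z / dx u)) (z i) := by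
    intro i
    refine dTerm_eq ?_
    have : ∀ᶠ q in 𝓝 (z i), q ^ 2 ≠ 1 := (continuous_pow 2).continuousAt.eventually_ne (hz2 i)
    exact this.mono fun q hq => (hE z hz2 q hq).1 i
  have h3 := Finset.sum_congr rfl fun i (_ : i ∈ Finset.univ) =>
    sum_residue_oddB_mul_form (Mix.form (hF i) z) hz₁ (hz i) (hA i)
  rw [Finset.sum_add_distrib, Finset.sum_sub_distrib, ← Finset.sum_div, ← Finset.mul_sum,
    ← Finset.mul_sum] at h3
  have h4 := sum_residue_form (Mix.form hG z) hz₁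
  rw [opA_corr hε0 (by omega) hz2 hz₁ (fun a ha => num_meromorphicAt h ih hz2 ha)
    (fun p hp => corr_eq_pp_num hε0 h ih hz2 hp), hres, hres, hε1,
    (hE z hz2 z₁ (sq_ne_one hz₁)).2, Finset.sum_congr rfl fun i _ => hd i, ← Finset.mul_sum]
  have h5 : ∀ A B C D P Q : ℂ, A + B = 2 * P / dx z₁ ^ 2 - 2 * Q →
      C + D = 2 * (G z₁ z) / dx z₁ ^ 2 →
      -(ε / 2) * (A + C + (B + D)) * dx z₁ = -ε * ((P + G z₁ z) / dx z₁ - dx z₁ * Q) := by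
    intro A B C D P Q h1 h2
    have : A + C + (B + D) = (A + B) + (C + D) := by ring
    rw [this, h1, h2]
    field_simp
    ring
  exact h5 _ _ _ _ _ _ h3 h4

theorem opA_corr_zero_two_mul_dx {ε : ℂ} (hε : ε = 1 ∨ ε = -1) {z₁ z₂ z₃ : ℂ} (h₁ : Generic z₁)
    (h₂ : Generic z₂) (h₃ : Generic z₃) (h₁₂ : Apart z₁ z₂) (h₁₃ : Apart z₁ z₃)
    (h₂₃ : Apart z₂ z₃) :
    opA (fun u => corr ε 0 2 u ![z₂, z₃]) (x z₁) * dx z₁ =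
      ε * (-(2 * Bodd z₁ z₂ * Bodd z₁ z₃ / dx z₁) + dTerm (fun u => Bodd u z₃) z₁ z₂ +
        dTerm (fun u => Bodd z₂ u) z₁ z₃) := by
  have hε0 : ε ≠ 0 := by rcases hε with rfl | rfl <;> norm_num
  have hε1 : 1 / (2 * ε) = ε / 2 := by rcases hε with rfl | rfl <;> norm_num
  have hdx := dx_ne_zero h₁.1 (sq_ne_one h₁)
  have hz2 : ∀ i, (![z₂, z₃] : Fin 2 → ℂ) i ^ 2 ≠ 1 := by
    intro i
    fin_cases i
    · exact sq_ne_one h₂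
    · exact sq_ne_one h₃
  have hne : z₂ ∉ ({z₃} : Finset ℂ) := fun h => h₂₃.1 (Finset.mem_singleton.1 h)
  have hinv2 : z₂⁻¹ ≠ z₃ := (h₂₃.ne_inv h₂.1).symm
  have hinv3 : z₃⁻¹ ≠ z₂ := fun h => hinv2 (by rw [← h, inv_inv])
  have ho2 : AnalyticAt ℂ (fun q => oddB q z₃) z₂ := oddB_analyticAt_inv h₂₃.1 hinv2
  have ho3 : AnalyticAt ℂ (fun q => oddB q z₂) z₃ := oddB_analyticAt_inv h₂₃.1.symm hinv3
  have h := sum_residue_mul_cauchyFactor (N := fun q => 2 * oddB q z₂ * oddB q z₃)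
    (W := {z₂, z₃}) h₁
    (fun v hv => by
      have i2 := inv_notMem_singleton h₂
      have i3 := inv_notMem_singleton h₃
      rw [Finset.mem_singleton] at i2 i3
      rcases Finset.mem_insert.1 hv with rfl | hv
      · exact ⟨h₂, by simp [i2, hinv2]⟩
      · obtain rfl := Finset.mem_singleton.1 hv
        refine ⟨h₃, ?_⟩
        simp only [Finset.mem_insert, Finset.mem_singleton, not_or]
        exact ⟨hinv3, i3⟩)
    (by
      simp only [Finset.mem_insert, Finset.mem_singleton, not_or]
      exact ⟨h₁₂.1, h₁₃.1⟩)
    (by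
      simp only [Finset.mem_insert, Finset.mem_singleton, not_or]
      exact ⟨(h₁₂.ne_inv h₁.1).symm, (h₁₃.ne_inv h₁.1).symm⟩)
    (fun q hq n1 n2 => by
      simp only [Finset.mem_insert, Finset.mem_singleton, not_or] at n1 n2
      exact (analyticAt_const.fun_mul (oddB_analyticAt_inv n1.1 n2.1)).fun_mul
        (oddB_analyticAt_inv n1.2 n2.2))
    (fun q => ((MeromorphicAt.const 2 q).fun_mul (oddB_meromorphicAt q _)).fun_mul
      (oddB_meromorphicAt q _))
    (fun q hq => by
      rw [oddB_inv hq, oddB_inv hq]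
      ring)
  have hswap : (fun q => 2 * oddB q z₂ * oddB q z₃ * cauchyFactor z₁ q) =
      fun q => 2 * oddB q z₃ * oddB q z₂ * cauchyFactor z₁ q := by
    funext q
    ring
  rw [Finset.sum_insert hne, Finset.sum_singleton,
    residue_oddB_mul h₂ h₁.1 h₁₂.1.symm (h₁₂.ne_inv h₁.1) ho2] at h
  nth_rewrite 3 [hswap] at h
  rw [residue_oddB_mul h₃ h₁.1 h₁₃.1.symm (h₁₃.ne_inv h₁.1) ho3] at h
  have hd2 : dTerm (fun u => Bodd u z₃) z₁ z₂ =
      dx z₁ * deriv (fun u => 1 / (x z₁ - x u) * (oddB u z₃ / dx u)) z₂ := by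
    refine dTerm_eq ?_
    filter_upwards [isOpen_ne.mem_nhds h₂.1] with q hq
    exact Bodd_eq_oddB hq z₃
  have hd3 : dTerm (fun u => Bodd z₂ u) z₁ z₃ =
      dx z₁ * deriv (fun u => 1 / (x z₁ - x u) * (oddB u z₂ / dx u)) z₃ :=
    dTerm_eq (Eventually.of_forall fun q => by
      simp only [Bodd_eq_oddB h₂.1, oddB_comm z₂ q])
  rw [opA_corr hε0 (by omega) hz2 h₁ (N := fun q => 2 * oddB q z₂ * oddB q z₃)
    (fun a _ => ((MeromorphicAt.const 2 a).fun_mul (oddB_meromorphicAt a _)).fun_mul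
      (oddB_meromorphicAt a _))
    (fun p hp => corr_zero_two hε0 hp hz2), h, hε1, hd2, hd3, Bodd_eq_oddB h₁.1,
    Bodd_eq_oddB h₁.1]
  field_simp
  ring

theorem opA_corr_one_zero_mul_dx {ε : ℂ} (hε : ε = 1 ∨ ε = -1) {z₁ : ℂ} (h₁ : Generic z₁) :
    opA (fun u => corr ε 1 0 u ![]) (x z₁) * dx z₁ =
      ε * (B z₁ (inv z₁) * dinv z₁ / dx z₁) := by
  have hε0 : ε ≠ 0 := by rcases hε with rfl | rfl <;> norm_num
  have hε1 : 1 / (2 * ε) = ε / 2 := by rcases hε with rfl | rfl <;> norm_num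
  have hdx := dx_ne_zero h₁.1 (sq_ne_one h₁)
  have h0 := h₁.1
  have h2 : z₁ ^ 2 - 1 ≠ 0 := sub_ne_zero.2 (sq_ne_one h₁)
  have hB : B z₁ (inv z₁) * dinv z₁ = -(1 / (z₁ ^ 2 - 1) ^ 2) := by
    have h3 : z₁ - inv z₁ = (z₁ ^ 2 - 1) / z₁ := by
      rw [inv]
      field_simp
    rw [B, h3, dinv, div_pow]
    field_simp
  rw [opA_corr hε0 (by omega) (fun i => i.elim0) h₁ (N := fun q => 1 / (q ^ 2 - 1) ^ 2)
    (fun a ha => Form.meromorphicAt one_div_sq_sub_one_mem_form ha)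
    (fun p hp => corr_one_zero hε0 hp _), sum_residue_form one_div_sq_sub_one_mem_form h₁, hε1, hB]
  field_simp

end P1Curve

end

theorem lemma3p5 (ε : ℂ) (hε : ε = 1 ∨ ε = -1) :
    -- the case `2g - 2 + n ≥ 2`, with `n = m + 1` and `I` identified with `Fin m`
    (∀ (g m : ℕ), 2 ≤ 2 * (g : ℤ) - 2 + ((m : ℤ) + 1) →
      ∀ (z₁ : ℂ) (z : Fin m → ℂ), P1Curve.Generic z₁ → (∀ i, P1Curve.Generic (z i)) →
        (∀ i, P1Curve.Apart z₁ (z i)) →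
        P1Curve.opA (fun u => P1Curve.corr ε g m u z) (P1Curve.x z₁) * P1Curve.dx z₁ =
          -ε * ((∑ i : Fin m,
                P1Curve.opL
                  (fun u => P1Curve.corr ε g _ u (P1Curve.sub z (Finset.univ.erase i))) z₁ (z i)) +
              (if g = 0 then 0
                else P1Curve.corr ε (g - 1) (m + 1) z₁ (Fin.cons z₁ z) / P1Curve.dx z₁) +
              ∑ h ∈ Finset.range (g + 1), ∑ J : Finset (Fin m),
                if 0 < 2 * (h : ℤ) - 2 + (1 + (J.card : ℤ)) ∧
                    0 < 2 * ((g - h : ℕ) : ℤ) - 2 + (1 + (Jᶜ.card : ℤ)) then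
                  P1Curve.corr ε h J.card z₁ (P1Curve.sub z J) *
                    P1Curve.corr ε (g - h) Jᶜ.card z₁ (P1Curve.sub z Jᶜ) / P1Curve.dx z₁
                else 0)) ∧
    -- the case `(g,n) = (0,3)`
    (∀ z₁ z₂ z₃ : ℂ, P1Curve.Generic z₁ → P1Curve.Generic z₂ → P1Curve.Generic z₃ →
      P1Curve.Apart z₁ z₂ → P1Curve.Apart z₁ z₃ → P1Curve.Apart z₂ z₃ →
        P1Curve.opA (fun u => P1Curve.corr ε 0 2 u ![z₂, z₃]) (P1Curve.x z₁) * P1Curve.dx z₁ =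
          ε * (-(2 * P1Curve.Bodd z₁ z₂ * P1Curve.Bodd z₁ z₃ / P1Curve.dx z₁) +
            P1Curve.dTerm (fun u => P1Curve.Bodd u z₃) z₁ z₂ +
            P1Curve.dTerm (fun u => P1Curve.Bodd z₂ u) z₁ z₃)) ∧
    -- the case `(g,n) = (1,1)`
    (∀ z₁ : ℂ, P1Curve.Generic z₁ →
      P1Curve.opA (fun u => P1Curve.corr ε 1 0 u ![]) (P1Curve.x z₁) * P1Curve.dx z₁ =
        ε * (P1Curve.B z₁ (P1Curve.inv z₁) * P1Curve.dinv z₁ / P1Curve.dx z₁)) := by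
  have hε0 : ε ≠ 0 := by rcases hε with rfl | rfl <;> norm_num
  refine ⟨fun g m hgm z₁ z hz₁ hz hA => ?_, fun z₁ z₂ z₃ h₁ h₂ h₃ h₁₂ h₁₃ h₂₃ =>
    P1Curve.opA_corr_zero_two_mul_dx hε h₁ h₂ h₃ h₁₂ h₁₃ h₂₃,
    fun z₁ h₁ => P1Curve.opA_corr_one_zero_mul_dx hε h₁⟩
  rw [P1Curve.opA_corr_mul_dx hε (by omega) hz₁ hz hA]
  congr 1
  simp only [P1Curve.opL, P1Curve.num, P1Curve.Bodd_eq_oddB hz₁.1, Finset.sum_sub_distrib, add_div,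
    Finset.sum_div, ite_div, zero_div, mul_div_assoc]
  ring
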